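/- Let $d\ge 0$ and let $\Omega$ be one of the path spaces $C_0([0,\infty),\mathbb R^d)$ (continuous paths null at $0$, uniform convergence on compact sets), $D([0,\infty),\mathbb R^d)$ or $D_0([0,\infty),\mathbb R^d)$ (càdlàg paths, respectively càdlàg paths null at $0$, with the Skorokhod topology), with its Borel $\sigma$-algebra. For $t\ge 0$ let $\Omega_t$ be, respectively, $C_0([0,t],\mathbb R^d)$ with uniform convergence, $D([0,t),\mathbb R^d)$ or $D_0([0,t),\mathbb R^d)$ with the topology transported from the Skorokhod topology on $[0,\infty)$ by the time change $u\mapsto u/(t-u)$ (a single point if $t=0$). Let $\Pi_t:\Omega\to\Omega_t$ be the restriction of paths, let ${\cal B}_t$ be the $\sigma$-algebra on $\Omega$ generated by the sets $\Pi_t^{-1}(U)$, $U\subset\Omega_t$ open, and identify $C_b(\Omega_t)$ with $\{g\circ\Pi_t : g\in C_b(\Omega_t)\}\subset C_b(\Omega)$. Let $\rho:C_b(\Omega)\to\mathbb R$ be a regular sublinear risk measure, that is: $\rho(f)\ge\rho(g)$ if $f\le g$; $\rho(f+a)=\rho(f)-a$ for $a\in\mathbb R$; $\rho(f+g)\le\rho(f)+\rho(g)$;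 $\rho(af)=a\rho(f)$ for $a\ge 0$; and $\rho(-f_n)\to 0$ for every sequence $(f_n)$ in $C_b(\Omega)$ decreasing pointwise to $0$. Let $c_\rho(f)=\rho(-|f|)$, let $L^1(c_\rho)$ be the Banach space obtained by completion and separation of $C_b(\Omega)$ for the semi-norm $c_\rho$, ordered by the closure of the cone of non-negative functions of $C_b(\Omega)$, and let $L^1_t(c_\rho)$ be the closure of $C_b(\Omega_t)$ in $L^1(c_\rho)$. Assume that $\rho$ factorizes through time on $L^1(c_\rho)$ into $(\rho_s)_{s\ge 0}$, that is, $\rho_s:L^1(c_\rho)\to L^1_s(c_\rho)$ and for all $s\ge 0$ and $X,Y\in L^1(c_\rho)$: (i) $\rho_s(X)\ge\rho_s(Y)$ if $X\le Y$; $\rho_s(X+Z)=\rho_s(X)-Z$ for $Z\in L^1_s(c_\rho)$; $\rho_s(X+Y)\le\rho_s(X)+\rho_s(Y)$; $\rho_s(aX)=a\rho_s(X)$ for real $a\ge0$; (ii) $\rho_s(X)=\rho_s(-\rho_t(X))$ for all $t\ge s$; (iii) $\rho_s(fX)\le f\rho_s(X)$ for all $f\in C_b(\Omega_s)$ with $f\ge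 0$; (iv) $\rho_0(f)=\rho(f)$ for all $f\in C_b(\Omega)$. A Borel probability measure $Q$ on $\Omega$ belongs to the unit ball of the dual of $L^1(c_\rho)$ if $f\mapsto E_Q(f)$ on $C_b(\Omega)$ extends to a continuous linear form of norm at most $1$ on $L^1(c_\rho)$; then every $X\in L^1(c_\rho)$ has a class in $L^1(Q)$, given by the continuous extension of the canonical map $C_b(\Omega)\to L^1(Q)$. Let $P$ be a probability measure in this unit ball which belongs to the canonical $c_\rho$-class, i.e. for all $X,Y\in L^1(c_\rho)$, $X=Y$ $P$-a.s. if and only if $X=Y$ in $L^1(c_\rho)$. Then for every $s\ge 0$: 1. There is a countable set $\{Q_n,\ n\in\mathbb N\}$ of probability measures in the unit ball of the dual of $L^1(c_\rho)$, whose restrictions to ${\cal B}_s$ are equal to that of $P$, such that for every $X\in L^1(c_\rho)$ $$\rho_s(X)=P\text{-}\operatorname*{ess\,sup}_{n\in\mathbb N}E_{Q_n}(-X\mid{\cal B}_s)\quad P\text{-a.s.}$$ 2. For every $X\in L^1(c_\rho)$ there is a probability measure $Q_X$ in the unit ball of the dual of $L^1(c_\rho)$, whose restriction to ${\cal B}_s$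 is equal to that of $P$, such that $$\rho_s(X)=E_{Q_X}(-X\mid{\cal B}_s)\quad P\text{-a.s.}$$ -/

import Mathlib

open Set Filter Topology MeasureTheory ProbabilityTheory UniformSpace
open scoped NNReal ENNReal BoundedContinuousFunction

noncomputable section

/-! ## The Skorokhod topology and the path spaces -/

/-- Pairs `(x, y)` of functions on `[0, ∞)` such that, for some increasing bijection `l` of `[0, ∞)`,
`|l u - u| ≤ 1 / (n + 1)` for all `u` and `|y (l u) - x u| ≤ 1 / (n + 1)` for all `u ≤ n`. -/
def skorokhodEntourage (E : Type) [PseudoMetricSpace E] (n : ℕ) :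
    Set ((ℝ≥0 → E) × (ℝ≥0 → E)) :=
  {p | ∃ l : ℝ≥0 ≃o ℝ≥0, (∀ u : ℝ≥0, dist (l u) u ≤ 1 / ((n : ℝ) + 1)) ∧
    ∀ u : ℝ≥0, (u : ℝ) ≤ n → dist (p.2 (l u)) (p.1 u) ≤ 1 / ((n : ℝ) + 1)}

lemma skorokhodEntourage_anti (E : Type) [PseudoMetricSpace E] {m n : ℕ} (h : m ≤ n) :
    skorokhodEntourage E n ⊆ skorokhodEntourage E m := by
  rintro p ⟨l, h1, h2⟩
  have hmn : (m : ℝ) ≤ n := by exact_mod_cast h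
  have h3 : 1 / ((n : ℝ) + 1) ≤ 1 / ((m : ℝ) + 1) :=
    one_div_le_one_div_of_le (by positivity) (by linarith)
  exact ⟨l, fun u => (h1 u).trans h3, fun u hu => (h2 u (hu.trans hmn)).trans h3⟩

/-- The uniform structure generated by the sets `skorokhodEntourage E n`. On càdlàg functions its
topology is Skorokhod's: `x_k → x` iff there are increasing bijections `l_k` of `[0, ∞)` with
`l_k u - u → 0` uniformly in `u` and `x_k (l_k u) - x u → 0` uniformly for `u` in compact sets. -/
@[reducible]
def skorokhodUniformSpace (E : Type) [PseudoMetricSpace E] : UniformSpace (ℝ≥0 → E) :=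
  UniformSpace.ofCore <| UniformSpace.Core.mkOfBasis
    { sets := range (skorokhodEntourage E)
      nonempty := range_nonempty _
      inter_sets := by
        rintro _ _ ⟨m, rfl⟩ ⟨n, rfl⟩
        exact ⟨_, ⟨max m n, rfl⟩, subset_inter (skorokhodEntourage_anti E (le_max_left m n))
          (skorokhodEntourage_anti E (le_max_right m n))⟩ }
    (by
      rintro _ ⟨n, rfl⟩ x
      exact ⟨OrderIso.refl _, fun u => by simp; positivity, fun u _ => by simp; positivity⟩)
    (by
      rintro _ ⟨n, rfl⟩
      refine ⟨_, ⟨n + 1, rfl⟩, ?_⟩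
      rintro ⟨x, y⟩ ⟨l, h1, h2⟩
      have h3 : 1 / (((n + 1 : ℕ) : ℝ) + 1) ≤ 1 / ((n : ℝ) + 1) :=
        one_div_le_one_div_of_le (by positivity) (by push_cast; linarith)
      have h4 : 1 / (((n + 1 : ℕ) : ℝ) + 1) ≤ 1 := by
        rw [div_le_one (by positivity)]; push_cast; linarith [(n.cast_nonneg : (0 : ℝ) ≤ n)]
      refine ⟨l.symm, fun u => ?_, fun u hu => ?_⟩
      · have := h1 (l.symm u)
        rw [OrderIso.apply_symm_apply, dist_comm] at this
        exact this.trans h3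
      · have hd := h1 (l.symm u)
        rw [OrderIso.apply_symm_apply, NNReal.dist_eq] at hd
        have := h2 (l.symm u) (by push_cast at *; linarith [(abs_le.1 hd).1])
        rw [OrderIso.apply_symm_apply, dist_comm] at this
        exact this.trans h3)
    (by
      rintro _ ⟨n, rfl⟩
      refine ⟨_, ⟨2 * n + 1, rfl⟩, ?_⟩
      rintro ⟨x, z⟩ ⟨y, ⟨l, h1, h2⟩, ⟨k, h3, h4⟩⟩
      have hn : (0 : ℝ) ≤ n := n.cast_nonneg
      have e : 1 / (((2 * n + 1 : ℕ) : ℝ) + 1) + 1 / (((2 * n + 1 : ℕ) : ℝ) + 1)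
          = 1 / ((n : ℝ) + 1) := by
        push_cast; field_simp; ring
      have h5 : 1 / (((2 * n + 1 : ℕ) : ℝ) + 1) ≤ 1 := by
        rw [div_le_one (by positivity)]; push_cast; linarith
      refine ⟨l.trans k, fun u => ?_, fun u hu => ?_⟩
      · rw [OrderIso.trans_apply, ← e]
        exact (dist_triangle _ _ _).trans (add_le_add (h3 (l u)) (h1 u))
      · have hd := h1 u
        rw [NNReal.dist_eq] at hd
        rw [OrderIso.trans_apply, ← e]
        exact (dist_triangle _ (y (l u)) _).trans (add_le_add
          (h4 (l u) (by push_cast at *; linarith [(abs_le.1 hd).2]))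
          (h2 u (by push_cast; linarith))))

/-- Right continuous with left limits. -/
def IsCadlag {I E : Type} [TopologicalSpace I] [Preorder I] [TopologicalSpace E] (x : I → E) :
    Prop :=
  ∀ u, ContinuousWithinAt x (Ici u) u ∧ ∃ a, Tendsto x (𝓝[<] u) (𝓝 a)

/-- For `x` defined on `[0, t)`, the function `x ∘ α_t⁻¹` on `[0, ∞)`, where
`α_t u = u / (t - u)`, that is `α_t⁻¹ v = t * v / (1 + v)`. (The value `0` is used for `t = 0` only,
where `[0, t)` is empty.) -/
def stretch {E : Type} [Zero E] (t : ℝ≥0) (x : Iio t → E) (v : ℝ≥0) : E :=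
  if h : t * v / (1 + v) < t then x ⟨t * v / (1 + v), h⟩ else 0

/-- The three spaces of `ℝ^d`-valued paths on `[0, ∞)`: continuous paths null at `0`,
càdlàg paths, càdlàg paths null at `0`. -/
inductive PathKind
  | continuousZero
  | cadlag
  | cadlagZero

/-- The path space `Ω`. -/
def PathSpace (d : ℕ) : PathKind → Type
  | .continuousZero => {x : C(ℝ≥0, EuclideanSpace ℝ (Fin d)) // x 0 = 0}
  | .cadlag => {x : ℝ≥0 → EuclideanSpace ℝ (Fin d) // IsCadlag x}
  | .cadlagZero => {x : ℝ≥0 → EuclideanSpace ℝ (Fin d) // IsCadlag x ∧ x 0 = 0}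

/-- The space `Ω_t`: continuous paths on `[0, t]`, or càdlàg paths on `[0, t)`
(null at `0` according to the kind). -/
def PathSpaceUpTo (d : ℕ) : PathKind → ℝ≥0 → Type
  | .continuousZero, t =>
      {x : C(Iic t, EuclideanSpace ℝ (Fin d)) // x ⟨0, mem_Iic.2 zero_le⟩ = 0}
  | .cadlag, t => {x : Iio t → EuclideanSpace ℝ (Fin d) // IsCadlag x}
  | .cadlagZero, t =>
      {x : Iio t → EuclideanSpace ℝ (Fin d) // IsCadlag x ∧ ∀ h : 0 < t, x ⟨0, h⟩ = 0}

/-- Uniform convergence on compact sets for continuous paths, the Skorokhod topology for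
càdlàg paths. -/
instance (d : ℕ) : (k : PathKind) → TopologicalSpace (PathSpace d k)
  | .continuousZero =>
      inferInstanceAs (TopologicalSpace {x : C(ℝ≥0, EuclideanSpace ℝ (Fin d)) // x 0 = 0})
  | .cadlag => (skorokhodUniformSpace _).toTopologicalSpace.induced fun x => x.1
  | .cadlagZero => (skorokhodUniformSpace _).toTopologicalSpace.induced fun x => x.1

/-- Uniform convergence for continuous paths on `[0, t]`. For càdlàg paths on `[0, t)`,
the topology transported from the Skorokhod topology on `[0, ∞)` by `u ↦ u / (t - u)`. -/
instance (d : ℕ) : (k : PathKind) → (t : ℝ≥0) → TopologicalSpace (PathSpaceUpTo d k t)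
  | .continuousZero, t => inferInstanceAs
      (TopologicalSpace {x : C(Iic t, EuclideanSpace ℝ (Fin d)) // x ⟨0, mem_Iic.2 zero_le⟩ = 0})
  | .cadlag, t => (skorokhodUniformSpace _).toTopologicalSpace.induced fun x => stretch t x.1
  | .cadlagZero, t => (skorokhodUniformSpace _).toTopologicalSpace.induced fun x => stretch t x.1

instance (d : ℕ) (k : PathKind) : MeasurableSpace (PathSpace d k) := borel _

instance (d : ℕ) (k : PathKind) : BorelSpace (PathSpace d k) := ⟨rfl⟩

lemma IsCadlag.restrict {E : Type} [TopologicalSpace E] {x : ℝ≥0 → E} (hx : IsCadlag x)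
    (t : ℝ≥0) : IsCadlag fun u : Iio t => x u := by
  intro u
  refine ⟨(hx u).1.comp continuous_subtype_val.continuousWithinAt fun v hv => hv, ?_⟩
  obtain ⟨a, ha⟩ := (hx u).2
  refine ⟨a, ha.comp ?_⟩
  exact tendsto_nhdsWithin_iff.2 ⟨(continuous_subtype_val.tendsto u).mono_left nhdsWithin_le_nhds,
    eventually_nhdsWithin_of_forall fun v hv => hv⟩

/-- The projection `Π_t : Ω → Ω_t`, restriction of paths to `[0, t]` or `[0, t)`. -/
def pathRestrict (d : ℕ) : (k : PathKind) → (t : ℝ≥0) → PathSpace d k → PathSpaceUpTo d k t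
  | .continuousZero, t, x => ⟨x.1.restrict (Iic t), x.2⟩
  | .cadlag, t, x => ⟨fun u => x.1 u, IsCadlag.restrict x.2 t⟩
  | .cadlagZero, t, x => ⟨fun u => x.1 u, IsCadlag.restrict x.2.1 t, fun _ => x.2.2⟩

/-- The `σ`-algebra on `Ω` generated by the open sets of `Ω_t`. -/
@[reducible]
def pathSigma (d : ℕ) (k : PathKind) (t : ℝ≥0) : MeasurableSpace (PathSpace d k) :=
  (borel (PathSpaceUpTo d k t)).comap (pathRestrict d k t)

/-! ## Sublinear regular risk measures on bounded continuous functions, and `L¹(c)` -/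

/-- A sublinear risk measure on `C_b(Ω)` that is regular: `ρ (-f_n) → 0` for every sequence `f_n`
in `C_b(Ω)` decreasing pointwise to `0`. -/
structure RegularSublinearRiskMeasure (Ω : Type*) [TopologicalSpace Ω] where
  toFun : (Ω →ᵇ ℝ) → ℝ
  anti : ∀ f g, f ≤ g → toFun g ≤ toFun f
  translation : ∀ f (a : ℝ), toFun (f + BoundedContinuousFunction.const Ω a) = toFun f - a
  subadd : ∀ f g, toFun (f + g) ≤ toFun f + toFun g
  pos_homog : ∀ (a : ℝ) f, 0 ≤ a → toFun (a • f) = a * toFun f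
  regular : ∀ f : ℕ → Ω →ᵇ ℝ, Antitone f → (∀ ω, Tendsto (fun n => f n ω) atTop (𝓝 0)) →
    Tendsto (fun n => toFun (-f n)) atTop (𝓝 0)

namespace RegularSublinearRiskMeasure

variable {Ω : Type*} [TopologicalSpace Ω] (ρ : RegularSublinearRiskMeasure Ω)

/-- The capacity `c_ρ(f) = ρ(-|f|)`. -/
def capacity (f : Ω →ᵇ ℝ) : ℝ := ρ.toFun (-|f|)

lemma toFun_zero : ρ.toFun 0 = 0 := by simpa using ρ.pos_homog 0 0 le_rfl

lemma capacity_mono {f g : Ω →ᵇ ℝ} (h : |f| ≤ |g|) : ρ.capacity f ≤ ρ.capacity g :=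
  ρ.anti _ _ (neg_le_neg h)

lemma capacity_smul (a : ℝ) (f : Ω →ᵇ ℝ) : ρ.capacity (a • f) = |a| * ρ.capacity f := by
  have : -|a • f| = |a| • (-|f|) := by
    ext ω
    simp [abs_mul]
  rw [capacity, this, ρ.pos_homog _ _ (abs_nonneg a), capacity]

/-- `C_b(Ω)` with the semi-norm `c_ρ`. -/
def CbSeminormed (_ρ : RegularSublinearRiskMeasure Ω) : Type _ := Ω →ᵇ ℝ

instance : AddCommGroup ρ.CbSeminormed := inferInstanceAs (AddCommGroup (Ω →ᵇ ℝ))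

instance : Module ℝ ρ.CbSeminormed := inferInstanceAs (Module ℝ (Ω →ᵇ ℝ))

/-- The identity between the two copies of `C_b(Ω)`. -/
def toCb : ρ.CbSeminormed ≃ₗ[ℝ] (Ω →ᵇ ℝ) := LinearEquiv.refl ℝ _

/-- The semi-norm `c_ρ` on `C_b(Ω)`. -/
def capacitySeminorm : AddGroupSeminorm ρ.CbSeminormed where
  toFun f := ρ.capacity (ρ.toCb f)
  map_zero' := by
    rw [map_zero, capacity]
    simpa using ρ.toFun_zero
  add_le' f g := by
    rw [map_add]
    refine le_trans (ρ.anti (-|ρ.toCb f| + -|ρ.toCb g|) _ ?_) (ρ.subadd _ _)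
    rw [← neg_add]
    exact neg_le_neg (abs_add_le _ _)
  neg' f := by
    rw [map_neg, capacity, capacity, abs_neg]

instance : SeminormedAddCommGroup ρ.CbSeminormed :=
  AddGroupSeminorm.toSeminormedAddCommGroup ρ.capacitySeminorm

lemma norm_eq_capacity (f : ρ.CbSeminormed) : ‖f‖ = ρ.capacity (ρ.toCb f) := rfl

instance : NormedSpace ℝ ρ.CbSeminormed where
  norm_smul_le a f := (ρ.capacity_smul a (ρ.toCb f)).le

/-- The Banach space `L¹(c_ρ)`: completion and separation of `C_b(Ω)` for `c_ρ`. -/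
abbrev L1c : Type _ := Completion ρ.CbSeminormed

/-- The canonical map `C_b(Ω) → L¹(c_ρ)`. -/
def toL1c (f : Ω →ᵇ ℝ) : ρ.L1c := (ρ.toCb.symm f : ρ.CbSeminormed)

/-- The order of `L¹(c_ρ)`: `X ≤ Y` iff `Y - X` is a limit of non negative elements of
`C_b(Ω)`. -/
def LeL1c (X Y : ρ.L1c) : Prop := Y - X ∈ closure (ρ.toL1c '' {f | 0 ≤ f})

/-- Multiplication by `f ∈ C_b(Ω)` on `C_b(Ω)`, for the semi-norm `c_ρ`. -/
def mulCb (f : Ω →ᵇ ℝ) : ρ.CbSeminormed →L[ℝ] ρ.CbSeminormed :=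
  LinearMap.mkContinuous
    { toFun := fun g => ρ.toCb.symm (f * ρ.toCb g)
      map_add' := fun g h => by rw [map_add, mul_add, map_add]
      map_smul' := fun a g => by rw [map_smul, mul_smul_comm, map_smul, RingHom.id_apply] } ‖f‖
    (by
      intro g
      change ρ.capacity (f * ρ.toCb g) ≤ ‖f‖ * ρ.capacity (ρ.toCb g)
      rw [← abs_of_nonneg (norm_nonneg f), ← ρ.capacity_smul]
      apply ρ.capacity_mono
      intro ω
      simpa [abs_mul] using mul_le_mul_of_nonneg_right (f.norm_coe_le_norm ω) (abs_nonneg _))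

/-- Multiplication by `f ∈ C_b(Ω)` on `L¹(c_ρ)`. -/
def mulL1c (f : Ω →ᵇ ℝ) : ρ.L1c →L[ℝ] ρ.L1c := (ρ.mulCb f).completion

lemma mulL1c_toL1c (f g : Ω →ᵇ ℝ) : ρ.mulL1c f (ρ.toL1c g) = ρ.toL1c (f * g) :=
  ContinuousLinearMap.completion_apply_coe _ _

section Time

variable {E : ℝ≥0 → Type*} [∀ t, TopologicalSpace (E t)] (π : ∀ t, Ω → E t)

/-- `C_b(Ω_t)` as a subset of `C_b(Ω)`, for the projections `π t : Ω → Ω_t`. -/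
def CbUpTo (t : ℝ≥0) : Set (Ω →ᵇ ℝ) := {f | ∃ g : E t →ᵇ ℝ, ∀ ω, f ω = g (π t ω)}

/-- `L¹_t(c_ρ)`, the closure of `C_b(Ω_t)` in `L¹(c_ρ)`. -/
def L1cUpTo (t : ℝ≥0) : Set ρ.L1c := closure (ρ.toL1c '' CbUpTo π t)

/-- `(r s)_{s ≥ 0}` is a sublinear dynamic risk measure on `L¹(c_ρ)`. -/
structure IsSublinearDynamic (r : ℝ≥0 → ρ.L1c → ρ.L1c) : Prop where
  mem : ∀ s X, r s X ∈ ρ.L1cUpTo π s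
  anti : ∀ s X Y, ρ.LeL1c X Y → ρ.LeL1c (r s Y) (r s X)
  translation : ∀ s X, ∀ Y ∈ ρ.L1cUpTo π s, r s (X + Y) = r s X - Y
  subadd : ∀ s X Y, ρ.LeL1c (r s (X + Y)) (r s X + r s Y)
  pos_homog : ∀ s (a : ℝ) X, 0 ≤ a → r s (a • X) = a • r s X

/-- `ρ` factorizes through time on `L¹(c_ρ)` into `(r s)_{s ≥ 0}`. -/
structure FactorizesInto (r : ℝ≥0 → ρ.L1c → ρ.L1c) : Prop where
  dynamic : ρ.IsSublinearDynamic π r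
  time_consistent : ∀ s t, s ≤ t → ∀ X, r s X = r s (-r t X)
  mul_le : ∀ s, ∀ f ∈ CbUpTo π s, 0 ≤ f → ∀ X, ρ.LeL1c (r s (ρ.mulL1c f X)) (ρ.mulL1c f (r s X))
  extends_toFun : ∀ f : Ω →ᵇ ℝ,
    r 0 (ρ.toL1c f) = ρ.toL1c (BoundedContinuousFunction.const Ω (ρ.toFun f))

end Time

/-! ## Probability measures in the dual of `L¹(c)` -/

variable [MeasurableSpace Ω] [BorelSpace Ω]

/-- `Q` belongs to the unit ball of the dual of `L¹(c_ρ)`: integration against `Q` on `C_b(Ω)`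
extends to a continuous linear form of norm at most `1`. -/
def MemDualBall (Q : ProbabilityMeasure Ω) : Prop :=
  ∃ l : ρ.L1c →L[ℝ] ℝ, ‖l‖ ≤ 1 ∧ ∀ f : Ω →ᵇ ℝ, l (ρ.toL1c f) = ∫ ω, f ω ∂(Q : Measure Ω)

/-- The class in `L¹(Q)` of an element of `L¹(c_ρ)`, for `Q` in the unit ball of the dual: the
continuous extension to `L¹(c_ρ)` of the canonical map `C_b(Ω) → L¹(Q)`. -/
def toLp (Q : ProbabilityMeasure Ω) : ρ.L1c → Lp ℝ 1 (Q : Measure Ω) :=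
  Completion.extension fun f : ρ.CbSeminormed =>
    BoundedContinuousFunction.toLp 1 (Q : Measure Ω) ℝ (ρ.toCb f)

/-- `P` belongs to the unit ball of the dual and to the canonical `c_ρ`-class: elements of
`L¹(c_ρ)` are equal iff they are equal `P`-a.s. -/
def IsCanonical (P : ProbabilityMeasure Ω) : Prop :=
  ρ.MemDualBall P ∧ ∀ X Y, ρ.toLp P X = ρ.toLp P Y ↔ X = Y

lemma uniformContinuous_of_memDualBall {Q : ProbabilityMeasure Ω} (hQ : ρ.MemDualBall Q) :
    UniformContinuous fun f : ρ.CbSeminormed =>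
      BoundedContinuousFunction.toLp 1 (Q : Measure Ω) ℝ (ρ.toCb f) := by
  obtain ⟨l, hl, h⟩ := hQ
  refine LipschitzWith.uniformContinuous (K := 1) (LipschitzWith.of_dist_le_mul fun f g => ?_)
  rw [dist_eq_norm, dist_eq_norm, NNReal.coe_one, one_mul]
  change ‖BoundedContinuousFunction.toLp 1 (Q : Measure Ω) ℝ (ρ.toCb f) -
    BoundedContinuousFunction.toLp 1 (Q : Measure Ω) ℝ (ρ.toCb g)‖ ≤ _
  rw [← map_sub]
  set u : Ω →ᵇ ℝ := ρ.toCb f - ρ.toCb g with hu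
  have h1 : ‖BoundedContinuousFunction.toLp 1 (Q : Measure Ω) ℝ u‖
      = ∫ ω, |u| ω ∂(Q : Measure Ω) := by
    rw [L1.norm_eq_integral_norm]
    refine integral_congr_ae ?_
    filter_upwards [BoundedContinuousFunction.coeFn_toLp (p := 1) (Q : Measure Ω) ℝ u] with ω hω
    rw [hω]; rfl
  have h2 : ‖ρ.toL1c |u|‖ = ‖f - g‖ := by
    rw [toL1c, Completion.norm_coe]
    change ρ.capacity |u| = ρ.capacity u
    rw [capacity, capacity, abs_abs]
  rw [h1, ← h |u|, ← h2]
  exact (le_abs_self _).trans ((l.le_opNorm _).trans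
    (mul_le_of_le_one_left (norm_nonneg _) hl))

lemma toLp_toL1c {Q : ProbabilityMeasure Ω} (hQ : ρ.MemDualBall Q) (f : Ω →ᵇ ℝ) :
    ρ.toLp Q (ρ.toL1c f) = BoundedContinuousFunction.toLp 1 (Q : Measure Ω) ℝ f :=
  Completion.extension_coe (ρ.uniformContinuous_of_memDualBall hQ) _

end RegularSublinearRiskMeasure

/-- `Z` is the `P`-essential supremum of the family `Y`. -/
def IsEssSup {Ω ι : Type*} [MeasurableSpace Ω] (P : Measure Ω) (Y : ι → Ω → ℝ) (Z : Ω → ℝ) :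
    Prop :=
  AEMeasurable Z P ∧ (∀ i, Y i ≤ᵐ[P] Z) ∧
    ∀ W : Ω → ℝ, AEMeasurable W P → (∀ i, Y i ≤ᵐ[P] W) → Z ≤ᵐ[P] W

end

/-! ## The Skorokhod topology -/

/-! Fix `s` and put `N X = E_P(ρ_s(-X))` (`dynExpect`). This is a monotone sublinear functional on
`L¹(c_ρ)`. Time consistency between `0` and `s` gives `N X ≤ ‖X‖` (`dynExpect_le_norm`). No
continuity of `ρ_0` is assumed, so its agreement with the norm on the positive cone comes from the
automatic continuity argument of `eq_norm_of_sublinear`.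

By Hahn–Banach each value `N X₀` is attained by a linear form dominated by `N`. Such a form is
positive, normalized and contractive. Regularity of `ρ` makes it continuous along sequences
decreasing to `0`, and the Daniell–Stone theorem turns it into a probability measure `Q`
(`exists_expect_le_dynExpect`). Translation invariance gives `N = E_P` on `L¹_s(c_ρ)`, so `Q` and
`P` agree on `B_s` (`measure_eq_of_expect_le`).

Property (iii) localizes the domination: for `0 ≤ f` in `C_b(Ω_s)`, `E_Q(-fX) ≤ E_P(ρ_s(fX)) ≤ E_P(f
ρ_s(X))`. Hence `E_Q(-X | B_s) ≤ ρ_s(X)` `P`-a.s. (`condExp_toLp_le`). If moreover `Q` attains `N`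
at `-X`, the nonnegative gap has integral zero and vanishes, which is the second claim.

For the first claim, `L¹(c_ρ)` is separable (`separableSpace_L1c`). Take `Q_n` attaining `N` at
`-D_n` for a dense sequence `D`. The gap between `ρ_s(X)` and `E_{Q_n}(-X | B_s)` has `P`-integral
at most `2‖X - D_n‖`, which can be made arbitrarily small (`isEssSup_condExp`).

All this needs from the path spaces only that `Ω` is pseudometrizable and second countable, that
`Ω_s` is pseudometrizable, and that restriction is continuous. -/

lemma skorokhodUniformity_hasBasis (E : Type) [PseudoMetricSpace E] :
    (@uniformity _ (skorokhodUniformSpace E)).HasBasis (fun _ : ℕ => True)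
      (skorokhodEntourage E) := by
  refine (FilterBasis.hasBasis _).to_hasBasis ?_ ?_
  · rintro _ ⟨n, rfl⟩
    exact ⟨n, trivial, subset_rfl⟩
  · intro n _
    exact ⟨_, ⟨n, rfl⟩, subset_rfl⟩

lemma skorokhodUniformity_isCountablyGenerated (E : Type) [PseudoMetricSpace E] :
    (@uniformity _ (skorokhodUniformSpace E)).IsCountablyGenerated :=
  (skorokhodUniformity_hasBasis E).isCountablyGenerated

lemma skorokhod_pseudoMetrizableSpace (E : Type) [PseudoMetricSpace E] :
    @TopologicalSpace.PseudoMetrizableSpace _ (skorokhodUniformSpace E).toTopologicalSpace := by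
  let _ := skorokhodUniformSpace E
  have := skorokhodUniformity_isCountablyGenerated E
  infer_instance

lemma skorokhod_nhds_hasBasis (E : Type) [PseudoMetricSpace E] (x : ℝ≥0 → E) :
    (@nhds _ (skorokhodUniformSpace E).toTopologicalSpace x).HasBasis (fun _ : ℕ => True)
      fun n => {y | (x, y) ∈ skorokhodEntourage E n} :=
  by
  let _ := skorokhodUniformSpace E
  exact nhds_basis_uniformity' (skorokhodUniformity_hasBasis E)

lemma exists_orderIso_of_strictMono {f : ℝ≥0 → ℝ≥0} (hf : StrictMono f) (hc : Continuous f)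
    (h0 : f 0 = 0) (hT : Tendsto f atTop atTop) : ∃ l : ℝ≥0 ≃o ℝ≥0, ∀ u, l u = f u := by
  have hs : Function.Surjective f := by
    refine hc.surjective hT ?_
    rw [OrderBot.atBot_eq]
    exact tendsto_pure_pure f ⊥ |>.trans (by rw [show f ⊥ = ⊥ from h0])
  exact ⟨hf.orderIsoOfSurjective f hs, fun u => rfl⟩

/-- A perturbation with slope at most `1/2` cannot destroy strict monotonicity of the identity, and
`u + h u ≥ u / 2` gives positivity and divergence at infinity. -/
lemma exists_orderIso_of_lipschitzWith {h : ℝ≥0 → ℝ} (hh : LipschitzWith (1 / 2) h)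
    (h0 : h 0 = 0) : ∃ l : ℝ≥0 ≃o ℝ≥0, ∀ u, (l u : ℝ) = u + h u := by
  have hd : ∀ u v : ℝ≥0, |h u - h v| ≤ 1 / 2 * |(u : ℝ) - v| := fun u v => by
    have := hh.dist_le_mul u v
    rwa [Real.dist_eq, NNReal.dist_eq] at this
  have hlow : ∀ u : ℝ≥0, (u : ℝ) / 2 ≤ u + h u := fun u => by
    have := hd u 0
    rw [h0, sub_zero, NNReal.coe_zero, sub_zero, abs_of_nonneg (NNReal.coe_nonneg u)] at this
    linarith [(abs_le.1 this).1]
  have hnn : ∀ u : ℝ≥0, 0 ≤ (u : ℝ) + h u := fun u => (by positivity : (0 : ℝ) ≤ u / 2).trans (hlow u)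
  have hco : ∀ u, ((u + h u).toNNReal : ℝ) = u + h u := fun u => Real.coe_toNNReal _ (hnn u)
  suffices H : ∃ l : ℝ≥0 ≃o ℝ≥0, ∀ u, l u = (u + h u).toNNReal by
    obtain ⟨l, hl⟩ := H
    exact ⟨l, fun u => by rw [hl, hco]⟩
  refine exists_orderIso_of_strictMono ?_ ?_ ?_ ?_
  · intro u v huv
    rw [← NNReal.coe_lt_coe] at huv ⊢
    have := hd u v
    rw [abs_of_neg (a := (u : ℝ) - v) (by linarith)] at this
    rw [hco, hco]
    linarith [(abs_le.1 this).2]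
  · exact continuous_real_toNNReal.comp (NNReal.continuous_coe.add hh.continuous)
  · simp [h0]
  · rw [← NNReal.tendsto_coe_atTop]
    simp only [hco]
    refine tendsto_atTop_mono hlow ?_
    exact (NNReal.tendsto_coe_atTop.2 tendsto_id).atTop_div_const (by norm_num)

/-- A finite set of points can be moved to any nearby points by an increasing bijection
close to the identity. -/
lemma exists_orderIso_moving (S : Finset ℝ≥0) (h0 : 0 ∈ S) {ε : ℝ} (hε : 0 < ε) :
    ∃ η > 0, ∀ ψ : ℝ≥0 → ℝ≥0, ψ 0 = 0 → (∀ a ∈ S, |(ψ a : ℝ) - a| ≤ η) →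
      ∃ l : ℝ≥0 ≃o ℝ≥0, (∀ a ∈ S, l a = ψ a) ∧ ∀ u, dist (l u) u ≤ ε := by
  obtain ⟨δ, hδ, hδ0⟩ : ∃ δ : ℝ, (∀ p ∈ (S ×ˢ S).filter (fun p : ℝ≥0 × ℝ≥0 => p.1 ≠ p.2),
      δ < |(p.1 : ℝ) - p.2|) ∧ 0 < δ := by
    refine Eventually.exists (f := 𝓝[>] (0 : ℝ)) (Eventually.and ?_ self_mem_nhdsWithin)
    rw [Filter.eventually_all_finset]
    intro p hp
    have : (p.1 : ℝ) ≠ p.2 := by exact_mod_cast (Finset.mem_filter.1 hp).2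
    exact (eventually_lt_nhds (abs_pos.2 (sub_ne_zero.2 this))).filter_mono nhdsWithin_le_nhds
  -- Distinct points of `S` are more than `δ` apart. Two displacements of size at most `δ / 4`
  -- differ by at most `δ / 2`, so the displacement is `1/2`-Lipschitz on `S`. It is then extended
  -- to all times and clamped to `[-ε, ε]`, which changes nothing on `S`.
  refine ⟨min (δ / 4) ε, lt_min (by positivity) hε, fun ψ hψ0 hψ => ?_⟩
  have hL : LipschitzOnWith (1 / 2) (fun a : ℝ≥0 => (ψ a : ℝ) - a) (S : Set ℝ≥0) := by
    refine LipschitzOnWith.of_dist_le_mul fun a ha b hb => ?_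
    rcases eq_or_ne a b with rfl | hab
    · simp
    have h1 := hδ (a, b) (by simp_all)
    have h2 := (hψ a ha).trans (min_le_left _ _)
    have h3 := (hψ b hb).trans (min_le_left _ _)
    rw [abs_le] at h2 h3
    rw [Real.dist_eq, NNReal.dist_eq]
    have h4 : |(ψ a : ℝ) - a - (ψ b - b)| ≤ δ / 2 := by rw [abs_le]; constructor <;> linarith
    push_cast
    linarith
  obtain ⟨g, hg, hgS⟩ := hL.extend_real
  have hg' : LipschitzWith (1 / 2) fun u => max (-ε) (min ε (g u)) := (hg.const_min ε).const_max _
  have hcl : ∀ a ∈ S, max (-ε) (min ε (g a)) = (ψ a : ℝ) - a := by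
    intro a ha
    have h2 := (hψ a ha).trans (min_le_right _ _)
    rw [← show (ψ a : ℝ) - a = g a from hgS ha]
    rw [abs_le] at h2
    rw [min_eq_right h2.2, max_eq_right h2.1]
  obtain ⟨l, hl⟩ := exists_orderIso_of_lipschitzWith hg' (by rw [hcl 0 h0, hψ0]; simp)
  refine ⟨l, fun a ha => ?_, fun u => ?_⟩
  · ext
    rw [hl, hcl a ha]; ring
  · rw [NNReal.dist_eq, hl, add_sub_cancel_left, abs_le]
    exact ⟨le_max_left _ _, max_le (by linarith) (min_le_left _ _)⟩

/-! ### Separability of the càdlàg functions by rational step functions -/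

/-- A càdlàg function has finitely many oscillations of size `ε` on a compact interval. -/
lemma IsCadlag.exists_finset {E : Type} [PseudoMetricSpace E] {x : ℝ≥0 → E} (hx : IsCadlag x)
    (T : ℝ≥0) {ε : ℝ} (hε : 0 < ε) :
    ∃ F : Finset ℝ≥0, ∀ v ∈ Icc 0 T, ∀ w, v ≤ w → (∀ a ∈ F, a ≤ v ↔ a ≤ w) →
      dist (x v) (x w) < ε := by
  refine isCompact_Icc.induction_on (p := fun s => ∃ F : Finset ℝ≥0, ∀ v ∈ s, ∀ w, v ≤ w →
    (∀ a ∈ F, a ≤ v ↔ a ≤ w) → dist (x v) (x w) < ε) ⟨∅, by simp⟩ ?_ ?_ ?_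
  · rintro s t hst ⟨F, hF⟩
    exact ⟨F, fun v hv => hF v (hst hv)⟩
  · rintro s t ⟨F, hF⟩ ⟨G, hG⟩
    classical
    refine ⟨F ∪ G, ?_⟩
    rintro v (hv | hv) w hvw h
    · exact hF v hv w hvw fun a ha => h a (Finset.mem_union_left _ ha)
    · exact hG v hv w hvw fun a ha => h a (Finset.mem_union_right _ ha)
  · intro u _
    obtain ⟨hr, a, ha⟩ := hx u
    have hr' : ∀ᶠ v in 𝓝 u, u ≤ v → dist (x v) (x u) < ε / 2 :=
      eventually_nhdsWithin_iff.1 (Metric.tendsto_nhds.1 hr (ε / 2) (by positivity))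
    have hl' : ∀ᶠ v in 𝓝 u, v < u → dist (x v) a < ε / 2 :=
      eventually_nhdsWithin_iff.1 (Metric.tendsto_nhds.1 ha (ε / 2) (by positivity))
    obtain ⟨δ, hδ, hB⟩ := Metric.eventually_nhds_iff.1 (hr'.and hl')
    set d : ℝ≥0 := ⟨δ, hδ.le⟩
    -- The point `u` keeps `v` and `w` on the same side of a possible jump; the point `u + d` keeps
    -- `w`, which is not restricted to the ball, from leaving it on the right.
    refine ⟨Metric.ball u δ, mem_nhdsWithin_of_mem_nhds (Metric.ball_mem_nhds u hδ), {u, u + d},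
      fun v hv w hvw h => ?_⟩
    have h1 := h u (by simp)
    have h2 := h (u + d) (by simp)
    rw [Metric.mem_ball] at hv
    have hv' := hv
    rw [NNReal.dist_eq, abs_lt] at hv
    have h3 : ¬ u + d ≤ v := by
      rw [not_le, ← NNReal.coe_lt_coe]
      change (v : ℝ) < u + δ
      linarith
    rw [h2, not_le, ← NNReal.coe_lt_coe] at h3
    change (w : ℝ) < u + δ at h3
    have hvw' : (v : ℝ) ≤ w := hvw
    have hw : dist w u < δ := by
      rw [NNReal.dist_eq, abs_lt]; constructor <;> linarith
    rcases le_or_gt u v with huv | huv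
    · have := (hB hv').1 huv
      have := (hB hw).1 (huv.trans hvw)
      linarith [dist_triangle_right (x v) (x w) (x u)]
    · have hwu : w < u := by
        rw [← not_le, ← h1, not_le]; exact huv
      have := (hB hv').2 huv
      have := (hB hw).2 hwu
      linarith [dist_triangle_right (x v) (x w) a]

/-- The step function that takes the value `L i` where exactly `i` points of `F` have been passed. -/
noncomputable def stepFunction {E : Type} (F : Finset ℝ≥0) (L : ℕ → E) (u : ℝ≥0) : E :=
  L (F.filter (· ≤ u)).card

/-- Between consecutive points of the finite set given by `IsCadlag.exists_finset` the path is
almost constant. A small time change moves these points to rational times, and as it is increasing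
it preserves the number of points already passed, the only datum on which a step function depends.
-/
lemma exists_stepFunction_mem_skorokhodEntourage {E : Type} [PseudoMetricSpace E] {D : ℕ → E}
    (hD : DenseRange D) {x : ℝ≥0 → E} (hx : IsCadlag x) (n : ℕ) :
    ∃ (F : Finset ℚ≥0) (M : List ℕ),
      (x, stepFunction (F.image fun q : ℚ≥0 => (q : ℝ≥0)) fun i => D (M.getD i 0)) ∈
        skorokhodEntourage E n := by
  classical
  set ε : ℝ := 1 / ((n : ℝ) + 1)
  have hε : 0 < ε := by positivity
  obtain ⟨F, hF⟩ := hx.exists_finset (n : ℝ≥0) (half_pos hε)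
  obtain ⟨η, hη, H⟩ := exists_orderIso_moving (insert 0 F) (Finset.mem_insert_self _ _) hε
  have hrat : ∀ a : ℝ≥0, ∃ q : ℚ≥0, |((q : ℝ≥0) : ℝ) - a| ≤ η ∧ (a = 0 → q = 0) := by
    intro a
    rcases eq_or_ne a 0 with rfl | ha
    · exact ⟨0, by simpa using hη.le, fun _ => rfl⟩
    · obtain ⟨q, hq1, hq2⟩ := exists_rat_btwn (show (a : ℝ) < a + η by linarith)
      have hq0 : 0 ≤ q := by
        have : (0 : ℝ) ≤ q := (NNReal.coe_nonneg a).trans hq1.le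
        exact_mod_cast this
      lift q to ℚ≥0 using hq0
      refine ⟨q, ?_, fun h => absurd h ha⟩
      have e : ((q : ℝ≥0) : ℝ) = (((q : ℚ≥0) : ℚ) : ℝ) := rfl
      rw [e, abs_le]
      constructor <;> linarith
  choose ψ hψ hψ0 using hrat
  obtain ⟨l, hl, hlε⟩ := H (fun a => (ψ a : ℝ≥0)) (by simp [hψ0 0 rfl]) fun a _ => hψ a
  have hval : ∀ i : ℕ, ∃ j : ℕ, ∀ u : ℝ≥0, (u : ℝ) ≤ n → (F.filter (· ≤ u)).card = i →
      dist (D j) (x u) ≤ ε := by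
    intro i
    by_cases hi : ∃ v : ℝ≥0, (v : ℝ) ≤ n ∧ (F.filter (· ≤ v)).card = i
    · obtain ⟨v, hvn, hv⟩ := hi
      obtain ⟨j, hj⟩ := hD.exists_dist_lt (x v) (half_pos hε)
      have key : ∀ p q : ℝ≥0, (p : ℝ) ≤ n → p ≤ q →
          (F.filter (· ≤ p)).card = (F.filter (· ≤ q)).card → dist (x p) (x q) < ε / 2 := by
        intro p q hp hpq hc
        refine hF p ⟨zero_le, by exact_mod_cast hp⟩ q hpq fun a ha => ?_
        have hsub : F.filter (· ≤ p) ⊆ F.filter (· ≤ q) := fun b hb => by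
          rw [Finset.mem_filter] at hb ⊢
          exact ⟨hb.1, hb.2.trans hpq⟩
        have := Finset.eq_of_subset_of_card_le hsub hc.ge
        simpa [ha] using Finset.ext_iff.1 this a
      refine ⟨j, fun u hu hcu => ?_⟩
      have h1 : dist (x v) (x u) < ε / 2 := by
        rcases le_total v u with h | h
        · exact key v u hvn h (hv.trans hcu.symm)
        · rw [dist_comm]; exact key u v hu h (hcu.trans hv.symm)
      rw [dist_comm] at hj
      linarith [dist_triangle (D j) (x v) (x u)]
    -- No time up to `n` has passed exactly `i` points, so any index will do.
    · exact ⟨0, fun u hu hcu => absurd ⟨u, hu, hcu⟩ hi⟩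
  choose j hj using hval
  refine ⟨F.image ψ, (List.range (F.card + 1)).map j, l, hlε, fun u hu => ?_⟩
  have hinj : Set.InjOn (fun a => (ψ a : ℝ≥0)) F := fun a ha b hb hab => by
    have h1 := hl a (Finset.mem_insert_of_mem ha)
    have h2 := hl b (Finset.mem_insert_of_mem hb)
    exact l.injective (h1.trans (hab.trans h2.symm))
  have hcard : (((F.image ψ).image fun q : ℚ≥0 => (q : ℝ≥0)).filter (· ≤ l u)).card
      = (F.filter (· ≤ u)).card := by
    rw [Finset.image_image, Finset.filter_image]
    refine (Finset.card_image_of_injOn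
      (hinj.mono fun a ha => (Finset.mem_filter.1 ha).1)).trans ?_
    congr 1
    refine Finset.filter_congr fun a ha => ?_
    have := l.le_iff_le (x := a) (y := u)
    rwa [hl a (Finset.mem_insert_of_mem ha)] at this
  have hle : (F.filter (· ≤ u)).card < F.card + 1 := Nat.lt_succ_of_le (Finset.card_filter_le _ _)
  simp only [stepFunction, hcard]
  -- At most `F.card` points are passed and the list has `F.card + 1` entries, so the default value
  -- is never read.
  rw [List.getD_eq_getElem _ _ (by simpa using hle)]
  simpa [ε] using hj _ u hu rfl

lemma isSeparable_isCadlag (E : Type) [PseudoMetricSpace E] [TopologicalSpace.SeparableSpace E] :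
    @TopologicalSpace.IsSeparable _ (skorokhodUniformSpace E).toTopologicalSpace
      {x : ℝ≥0 → E | IsCadlag x} := by
  rcases isEmpty_or_nonempty E with hE | hE
  · exact ⟨∅, countable_empty, fun x => (hE.false (x 0)).elim⟩
  refine ⟨range fun p : Finset ℚ≥0 × List ℕ =>
    stepFunction (p.1.image fun q : ℚ≥0 => (q : ℝ≥0))
      fun i => TopologicalSpace.denseSeq E (p.2.getD i 0), countable_range _, fun x hx => ?_⟩
  let _ := (skorokhodUniformSpace E).toTopologicalSpace
  refine (mem_closure_iff_nhds_basis (skorokhod_nhds_hasBasis E x)).2 ?_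
  intro n _
  obtain ⟨F, M, h⟩ := exists_stepFunction_mem_skorokhodEntourage
    (TopologicalSpace.denseRange_denseSeq E) hx n
  exact ⟨_, ⟨(F, M), rfl⟩, h⟩

/-- Separability passes to subsets in a pseudometrizable space, where it gives second countability
of the range of `g`; this is pulled back along the inducing map onto the range. -/
lemma skorokhod_induced_secondCountableTopology {E I : Type} [PseudoMetricSpace E]
    [TopologicalSpace.SeparableSpace E] (g : I → ℝ≥0 → E) (hg : ∀ i, IsCadlag (g i)) :
    @SecondCountableTopology I ((skorokhodUniformSpace E).toTopologicalSpace.induced g) := by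
  let _ := (skorokhodUniformSpace E).toTopologicalSpace
  have := skorokhod_pseudoMetrizableSpace E
  let _ := TopologicalSpace.pseudoMetrizableSpacePseudoMetric (ℝ≥0 → E)
  have hs : TopologicalSpace.IsSeparable (range g) :=
    (isSeparable_isCadlag E).mono (range_subset_iff.2 hg)
  have := hs.secondCountableTopology
  let _ := TopologicalSpace.induced g inferInstance
  have hi : IsInducing (rangeFactorization g) :=
    (IsInducing.of_comp_iff IsInducing.subtypeVal).1 ⟨rfl⟩
  exact hi.secondCountableTopology

/-! ### Continuity of restriction for the Skorokhod topologies -/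

lemma stretch_restrict {E : Type} [Zero E] {t : ℝ≥0} (ht : 0 < t) (x : ℝ≥0 → E) (v : ℝ≥0) :
    stretch t (fun u : Iio t => x u) v = x (t * v / (1 + v)) := by
  have h : t * v / (1 + v) < t := by
    rw [div_lt_iff₀ (by positivity), mul_add, mul_one]
    exact lt_add_of_pos_left _ ht
  rw [stretch, dif_pos h]

/-- With `A = α_t` and `B = α_t⁻¹`, the time change `l` should be conjugated into `A ∘ l ∘ B`. But
`l` need not preserve `[0, t)`. Only `v ≤ n` matters for the values, and there `B v` stays at
distance at least `t / (1 + n)` from `t`; a sufficiently small displacement keeps `l (B v)` in a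
region where the distortion by `A` is controlled. -/
lemma exists_stretch_restrict_mem_skorokhodEntourage (E : Type) [PseudoMetricSpace E] [Zero E]
    (t : ℝ≥0) (n : ℕ) : ∃ N, ∀ x y : ℝ≥0 → E, (x, y) ∈ skorokhodEntourage E N →
      (stretch t (fun u : Iio t => x u), stretch t (fun u : Iio t => y u)) ∈
        skorokhodEntourage E n := by
  rcases eq_zero_or_pos t with rfl | ht
  · refine ⟨0, fun x y _ => ⟨OrderIso.refl _, fun u => by simp; positivity, fun u _ => ?_⟩⟩
    simp [stretch]
    positivity
  have ht' : (0 : ℝ) < t := ht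
  -- In order, the summands give the precision `1 / (n + 1)` for values, put every `B v` below the
  -- horizon `N`, bound the distortion of time by `1 / (n + 1)`, and keep `l (B v)` at distance at
  -- least `t / (2 * (1 + n))` from `t`.
  obtain ⟨N, hN⟩ := exists_nat_ge (n + t + 2 * (1 + n) ^ 3 / t + 2 * (1 + n) / t : ℝ)
  have hn0 : (0 : ℝ) ≤ n := n.cast_nonneg
  set δ : ℝ := 1 / ((N : ℝ) + 1) with hδ
  have hNt : (t : ℝ) ≤ N ∧ (n : ℝ) ≤ N := by
    have : (0 : ℝ) ≤ 2 * (1 + n) ^ 3 / t + 2 * (1 + n) / t := by positivity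
    constructor <;> linarith
  have hδ1 : δ * (2 * (1 + n)) ≤ t := by
    have : (0 : ℝ) ≤ n + t + 2 * (1 + n) ^ 3 / t := by positivity
    have h2 : 2 * (1 + n) / t ≤ (N : ℝ) + 1 := by linarith
    rw [div_le_iff₀ ht'] at h2
    rw [hδ, div_mul_eq_mul_div, one_mul, div_le_iff₀ (by positivity)]
    linarith
  have hδ2 : δ * (2 * (1 + n) ^ 3) ≤ t := by
    have : (0 : ℝ) ≤ n + t + 2 * (1 + n) / t := by positivity
    have h2 : 2 * (1 + n) ^ 3 / t ≤ (N : ℝ) + 1 := by linarith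
    rw [div_le_iff₀ ht'] at h2
    rw [hδ, div_mul_eq_mul_div, one_mul, div_le_iff₀ (by positivity)]
    linarith
  refine ⟨N, ?_⟩
  rintro x y ⟨l, hl, hxy⟩
  set B : ℝ≥0 → ℝ≥0 := fun v => t * v / (1 + v) with hB
  set A : ℝ≥0 → ℝ≥0 := fun w => w / (t - w) with hA
  have hBco : ∀ v, (B v : ℝ) = t - t / (1 + v) := fun v => by
    have : (0 : ℝ) < 1 + v := by positivity
    simp only [hB]
    push_cast
    field_simp
    ring
  have hAco : ∀ w, w < t → (A w : ℝ) = t / (t - w) - 1 := fun w hw => by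
    have h1 : (0 : ℝ) < t - w := sub_pos.2 hw
    simp only [hA]
    rw [NNReal.coe_div, NNReal.coe_sub hw.le]
    field_simp
    ring
  have hBm : StrictMono B := fun u v huv => by
    have huv' : (u : ℝ) < v := huv
    rw [← NNReal.coe_lt_coe, hBco, hBco]
    have : (t : ℝ) / (1 + v) < t / (1 + u) :=
      div_lt_div_of_pos_left ht' (by positivity) (by linarith)
    linarith
  have hBA : ∀ w, w < t → B (A w) = w := fun w hw => by
    have h1 : (0 : ℝ) < t - w := sub_pos.2 hw
    rw [← NNReal.coe_inj, hBco, hAco w hw, add_sub_cancel, div_div_cancel₀ ht'.ne',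
      sub_sub_cancel]
  have hup : ∀ v : ℝ≥0, (v : ℝ) ≤ n → (l (B v) : ℝ) ≤ t - t / (2 * (1 + n)) := by
    intro v hv
    have h1 := hl (B v)
    rw [NNReal.dist_eq, hBco] at h1
    have h2 : (t : ℝ) / (1 + n) ≤ t / (1 + v) :=
      div_le_div_of_nonneg_left ht'.le (by positivity) (by linarith)
    have h3 : δ ≤ t / (2 * (1 + n)) := by rwa [le_div_iff₀ (by positivity)]
    have h4 : (t : ℝ) / (1 + n) = 2 * (t / (2 * (1 + n))) := by field_simp
    linarith [(abs_le.1 h1).2]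
  have hlt : ∀ v : ℝ≥0, (v : ℝ) ≤ n → l (B v) < t := fun v hv => by
    have : (0 : ℝ) < t / (2 * (1 + n)) := by positivity
    rw [← NNReal.coe_lt_coe]
    linarith [hup v hv]
  have hmono : ∀ u v : ℝ≥0, (v : ℝ) ≤ n → u < v → A (l (B u)) < A (l (B v)) := by
    intro u v hv huv
    have h1 : (l (B u) : ℝ) < l (B v) := l.strictMono (hBm huv)
    have h2 : (l (B v) : ℝ) < t := hlt v hv
    rw [← NNReal.coe_lt_coe, hAco _ (hlt v hv), hAco _ (hlt u (le_trans huv.le hv))]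
    have : (t : ℝ) / (t - l (B u)) < t / (t - l (B v)) :=
      div_lt_div_of_pos_left ht' (by linarith) (by linarith)
    linarith
  have hclose : ∀ v : ℝ≥0, (v : ℝ) ≤ n → |(A (l (B v)) : ℝ) - v| ≤ 1 / ((n : ℝ) + 1) := by
    intro v hv
    have h1 := hl (B v)
    have h2 := hup v hv
    have hc : (0 : ℝ) < t / (2 * (1 + n)) := by positivity
    have h5 : (v : ℝ) = t / (t - B v) - 1 := by
      rw [hBco]
      field_simp
      ring
    have h6 : (t : ℝ) / (1 + n) ≤ t - B v := by
      rw [hBco, sub_sub_cancel]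
      exact div_le_div_of_nonneg_left ht'.le (by positivity) (by linarith)
    have hp : (0 : ℝ) < t / (1 + n) := by positivity
    rw [NNReal.dist_eq] at h1
    rw [hAco _ (hlt v hv)]
    have h7 : (t : ℝ) / (t - l (B v)) - 1 - v
        = t * (l (B v) - B v) / ((t - l (B v)) * (t - B v)) := by
      have e1 : (t : ℝ) - l (B v) ≠ 0 := by linarith
      have e2 : (t : ℝ) - B v ≠ 0 := by linarith
      calc (t : ℝ) / (t - l (B v)) - 1 - v = t / (t - l (B v)) - t / (t - B v) := by
            linarith
        _ = _ := by field_simp; ring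
    have h9 : (0 : ℝ) < (t - l (B v)) * (t - B v) := mul_pos (by linarith) (by linarith)
    rw [h7, abs_div, abs_mul, abs_of_pos ht', abs_of_pos h9, div_le_iff₀ h9]
    have h8 : t / (2 * (1 + n)) * (t / (1 + n)) ≤ (t - l (B v) : ℝ) * (t - B v) :=
      mul_le_mul (by linarith) h6 hp.le (by linarith)
    calc (t : ℝ) * |(l (B v) : ℝ) - B v| ≤ t * δ := by gcongr
      _ ≤ 1 / ((n : ℝ) + 1) * (t / (2 * (1 + n)) * (t / (1 + n))) := by
          have e : 1 / ((n : ℝ) + 1) * (t / (2 * (1 + n)) * (t / (1 + n)))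
            = t * t / (2 * (1 + n) ^ 3) := by field_simp; ring
          rw [e, le_div_iff₀ (by positivity)]
          nlinarith
      _ ≤ _ := by gcongr
  have hmin : ∀ v : ℝ≥0, ((min v n : ℝ≥0) : ℝ) ≤ n := fun v => by simp
  -- The conjugated time change is used up to `n` and continued with slope one; the subtraction `v -
  -- n` is truncated, hence zero before `n`.
  obtain ⟨k, hk⟩ := exists_orderIso_of_strictMono
    (f := fun v => A (l (B (min v n))) + (v - n)) (by
      intro u v huv
      simp only
      rcases le_or_gt v n with hv | hv
      · rw [min_eq_left hv, min_eq_left (huv.le.trans hv), tsub_eq_zero_of_le hv,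
          tsub_eq_zero_of_le (huv.le.trans hv), add_zero, add_zero]
        exact hmono u v (by exact_mod_cast hv) huv
      · rw [min_eq_right hv.le]
        rcases le_or_gt u n with hu | hu
        · rw [min_eq_left hu, tsub_eq_zero_of_le hu]
          refine add_lt_add_of_le_of_lt ?_ (tsub_pos_of_lt hv)
          rcases hu.eq_or_lt with rfl | hu
          · rfl
          · exact (hmono u n (by simp) hu).le
        · rw [min_eq_right hu.le]
          gcongr
          exact tsub_lt_tsub_right_of_le hu.le huv) (by
      have hBc : Continuous B := by
        refine Continuous.div (by fun_prop) (by fun_prop) fun v => by positivity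
      have h1 : Continuous fun v : ℝ≥0 => l (B (min v n)) :=
        l.continuous.comp (hBc.comp (by fun_prop))
      refine Continuous.add (Continuous.div h1 (continuous_const.sub h1) fun v => ?_) (by fun_prop)
      exact (tsub_pos_of_lt (hlt _ (hmin v))).ne') (by
      have : l 0 = 0 := l.map_bot
      simp [hB, hA, this]) (by
      refine tendsto_atTop_mono (f := fun v : ℝ≥0 => v - n) (fun v => le_add_self) ?_
      refine tendsto_atTop_atTop.2 fun b => ⟨b + n, fun a ha => le_tsub_of_add_le_right ha⟩)
  refine ⟨k, fun v => ?_, fun v hv => ?_⟩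
  · rw [NNReal.dist_eq, hk]
    have h1 := hclose _ (hmin v)
    have h2 : (v : ℝ) = (min v n : ℝ≥0) + (v - n : ℝ≥0) := by
      have : min v (n : ℝ≥0) + (v - n) = v := by
        rw [add_comm]; exact tsub_add_min
      exact_mod_cast this.symm
    have h3 : ((A (l (B (min v n))) + (v - n) : ℝ≥0) : ℝ) - v
        = A (l (B (min v n))) - (min v n : ℝ≥0) := by
      rw [NNReal.coe_add]
      linarith
    rwa [h3]
  · have hv' : v ≤ n := by exact_mod_cast hv
    rw [hk, min_eq_left hv', tsub_eq_zero_of_le hv', add_zero]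
    simp only
    rw [stretch_restrict ht, stretch_restrict ht]
    have h2 := hBA _ (hlt v hv)
    simp only [hB] at h2 ⊢
    rw [h2]
    refine (hxy (B v) ?_).trans ?_
    · have : (0 : ℝ) ≤ t / (1 + v) := by positivity
      rw [hBco]; linarith [hNt.1]
    · exact one_div_le_one_div_of_le (by positivity) (by linarith [hNt.2])

/-- A jump at time `t` does no harm: the topology on `[0, t)` compares values only on intervals
staying away from `t`. -/
lemma continuous_stretch_restrict {E I : Type} [PseudoMetricSpace E] [Zero E] (t : ℝ≥0)
    (g : I → ℝ≥0 → E) :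
    @Continuous I (ℝ≥0 → E) ((skorokhodUniformSpace E).toTopologicalSpace.induced g)
      (skorokhodUniformSpace E).toTopologicalSpace
      fun i => stretch t (fun u : Iio t => g i u) := by
  let _ := (skorokhodUniformSpace E).toTopologicalSpace
  have hc : Continuous fun x : ℝ≥0 → E => stretch t (fun u : Iio t => x u) := by
    refine continuous_iff_continuousAt.2 fun x => ?_
    refine ((skorokhod_nhds_hasBasis E _).tendsto_iff (skorokhod_nhds_hasBasis E _)).2 ?_
    intro n _
    obtain ⟨N, hN⟩ := exists_stretch_restrict_mem_skorokhodEntourage E t n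
    exact ⟨N, trivial, fun y hy => hN x y hy⟩
  let _ := TopologicalSpace.induced g inferInstance
  exact hc.comp continuous_induced_dom

/-! ### Topological properties of the path spaces -/

instance (d : ℕ) (k : PathKind) : TopologicalSpace.PseudoMetrizableSpace (PathSpace d k) := by
  cases k
  · exact (IsInducing.subtypeVal (t := {x : C(ℝ≥0, EuclideanSpace ℝ (Fin d)) |
      x 0 = 0})).pseudoMetrizableSpace
  all_goals
    let _ := (skorokhodUniformSpace (EuclideanSpace ℝ (Fin d))).toTopologicalSpace
    have := skorokhod_pseudoMetrizableSpace (EuclideanSpace ℝ (Fin d))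
    exact IsInducing.pseudoMetrizableSpace ⟨rfl⟩

instance (d : ℕ) (k : PathKind) (t : ℝ≥0) :
    TopologicalSpace.PseudoMetrizableSpace (PathSpaceUpTo d k t) := by
  cases k
  · have : CompactSpace (Iic t) := isCompact_iff_compactSpace.1 (by
      rw [← Icc_bot]; exact isCompact_Icc)
    exact inferInstanceAs (TopologicalSpace.PseudoMetrizableSpace
      {x : C(Iic t, EuclideanSpace ℝ (Fin d)) // x ⟨0, mem_Iic.2 zero_le⟩ = 0})
  all_goals
    let _ := (skorokhodUniformSpace (EuclideanSpace ℝ (Fin d))).toTopologicalSpace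
    have := skorokhod_pseudoMetrizableSpace (EuclideanSpace ℝ (Fin d))
    exact IsInducing.pseudoMetrizableSpace ⟨rfl⟩

instance (d : ℕ) (k : PathKind) : SecondCountableTopology (PathSpace d k) := by
  cases k
  · exact (IsInducing.subtypeVal (t := {x : C(ℝ≥0, EuclideanSpace ℝ (Fin d)) |
      x 0 = 0})).secondCountableTopology
  · exact skorokhod_induced_secondCountableTopology _ fun x => x.2
  · exact skorokhod_induced_secondCountableTopology _ fun x => x.2.1

instance (d : ℕ) (k : PathKind) : Nonempty (PathSpace d k) := by
  have h : IsCadlag fun _ : ℝ≥0 => (0 : EuclideanSpace ℝ (Fin d)) := fun u =>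
    ⟨continuousWithinAt_const, 0, tendsto_const_nhds⟩
  cases k
  · exact ⟨⟨0, rfl⟩⟩
  · exact ⟨⟨_, h⟩⟩
  · exact ⟨⟨_, h, rfl⟩⟩

lemma continuous_pathRestrict (d : ℕ) (k : PathKind) (t : ℝ≥0) :
    Continuous (pathRestrict d k t) := by
  cases k
  · exact Continuous.subtype_mk ((ContinuousMap.continuous_restrict (Iic t)).comp
      continuous_subtype_val) _
  all_goals
    exact continuous_induced_rng.2 (continuous_stretch_restrict t _)

/-! ## The Daniell–Stone theorem for bounded continuous functions -/

section Daniell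

variable {Ω : Type*} [TopologicalSpace Ω]

/-- Continuous functions with values in `[0, 1]` that vanish outside `G`. -/
def unitFunctions (G : Set Ω) : Set (Ω →ᵇ ℝ) :=
  {f | (∀ ω, 0 ≤ f ω) ∧ (∀ ω, f ω ≤ 1) ∧ ∀ ω, ω ∉ G → f ω = 0}

lemma unitFunctions_nonempty (G : Set Ω) : (unitFunctions G).Nonempty :=
  ⟨0, fun _ => le_rfl, fun _ => zero_le_one, fun _ _ => rfl⟩

/-- The supremum of a functional over the continuous functions below the indicator of `G`. -/
noncomputable def openMass (l : (Ω →ᵇ ℝ) →ₗ[ℝ] ℝ) (G : Set Ω) : ℝ≥0∞ :=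
  ⨆ f ∈ unitFunctions G, ENNReal.ofReal (l f)

/-- The bounded continuous function `min 1 (k * max 0 g)`. -/
noncomputable def unitTrunc (g : C(Ω, ℝ)) (k : ℝ) : Ω →ᵇ ℝ :=
  BoundedContinuousFunction.ofNormedAddCommGroup (fun ω => max 0 (min 1 (k * g ω)))
    (by fun_prop) 1 (fun ω => by
      rw [Real.norm_of_nonneg (le_max_left _ _)]
      exact max_le zero_le_one (min_le_left _ _))

lemma unitTrunc_apply (g : C(Ω, ℝ)) (k : ℝ) (ω : Ω) :
    unitTrunc g k ω = max 0 (min 1 (k * g ω)) := rfl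

lemma unitTrunc_nonneg (g : C(Ω, ℝ)) (k : ℝ) (ω : Ω) : 0 ≤ unitTrunc g k ω := le_max_left _ _

lemma unitTrunc_le_one (g : C(Ω, ℝ)) (k : ℝ) (ω : Ω) : unitTrunc g k ω ≤ 1 :=
  max_le zero_le_one (min_le_left _ _)

lemma exists_continuousMap_pos_iff [TopologicalSpace.PseudoMetrizableSpace Ω] {G : Set Ω}
    (hG : IsOpen G) : ∃ g : C(Ω, ℝ), (∀ ω, 0 ≤ g ω) ∧ ∀ ω, 0 < g ω ↔ ω ∈ G := by
  let _ := TopologicalSpace.pseudoMetrizableSpacePseudoMetric Ω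
  -- The distance to the empty set is `0` by convention, so `G = univ` is treated apart.
  rcases Gᶜ.eq_empty_or_nonempty with h | h
  · refine ⟨1, fun ω => zero_le_one, fun ω => ?_⟩
    simp [compl_empty_iff.1 h]
  · refine ⟨⟨fun ω => Metric.infDist ω Gᶜ, by fun_prop⟩, fun ω => Metric.infDist_nonneg,
      fun ω => ?_⟩
    have := hG.isClosed_compl.notMem_iff_infDist_pos h (x := ω)
    simpa using this.symm

variable {l : (Ω →ᵇ ℝ) →ₗ[ℝ] ℝ}

lemma ofReal_le_openMass {G : Set Ω} {f : Ω →ᵇ ℝ} (hf : f ∈ unitFunctions G) :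
    ENNReal.ofReal (l f) ≤ openMass l G :=
  le_iSup₂ (f := fun f (_ : f ∈ unitFunctions G) => ENNReal.ofReal (l f)) f hf

lemma openMass_mono {G H : Set Ω} (h : G ⊆ H) : openMass l G ≤ openMass l H :=
  iSup₂_le fun _ hf => ofReal_le_openMass ⟨hf.1, hf.2.1, fun ω hω => hf.2.2 ω fun hG => hω (h hG)⟩

lemma openMass_empty : openMass l (∅ : Set Ω) = 0 := by
  refine le_antisymm (iSup₂_le fun f hf => ?_) zero_le
  have : f = 0 := by
    ext ω
    exact hf.2.2 ω (notMem_empty _)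
  simp [this]

lemma map_mono_of_pos (hpos : ∀ f : Ω →ᵇ ℝ, 0 ≤ f → 0 ≤ l f) {f g : Ω →ᵇ ℝ} (h : f ≤ g) :
    l f ≤ l g := by
  have := hpos (g - f) (sub_nonneg.2 h)
  rw [map_sub] at this
  linarith

lemma openMass_univ (hpos : ∀ f : Ω →ᵇ ℝ, 0 ≤ f → 0 ≤ l f) (h1 : l 1 = 1) :
    openMass l (univ : Set Ω) = 1 := by
  refine le_antisymm (iSup₂_le fun f hf => ?_) ?_
  · rw [ENNReal.ofReal_le_one, ← h1]
    exact map_mono_of_pos hpos hf.2.1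
  · rw [← ENNReal.ofReal_one, ← h1]
    exact ofReal_le_openMass ⟨fun _ => zero_le_one, fun _ => le_rfl, fun ω h => absurd trivial h⟩

lemma tendsto_map_of_monotone
    (hreg : ∀ f : ℕ → Ω →ᵇ ℝ, Antitone f → (∀ ω, Tendsto (fun n => f n ω) atTop (𝓝 0)) →
      Tendsto (fun n => l (f n)) atTop (𝓝 0)) {f : Ω →ᵇ ℝ} {g : ℕ → Ω →ᵇ ℝ} (hg : Monotone g)
    (hlim : ∀ ω, Tendsto (fun n => g n ω) atTop (𝓝 (f ω))) :
    Tendsto (fun n => l (g n)) atTop (𝓝 (l f)) := by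
  have := hreg (fun n => f - g n) (fun m n h => sub_le_sub_left (hg h) f) fun ω => by
    simpa using (hlim ω).const_sub (f ω)
  simp only [map_sub] at this
  simpa using this.const_sub (l f)

/-- If `f ≤ 1` vanishes off the union, then `f ⊓ S k` increases to `f`, where `S k` sums the first
`k` truncated bumps of the `G i`. Regularity passes to the limit in `l`, and each bump is a
competitor for its own `openMass l (G i)`. -/
lemma openMass_iUnion_le [TopologicalSpace.PseudoMetrizableSpace Ω]
    (hpos : ∀ f : Ω →ᵇ ℝ, 0 ≤ f → 0 ≤ l f)
    (hreg : ∀ f : ℕ → Ω →ᵇ ℝ, Antitone f → (∀ ω, Tendsto (fun n => f n ω) atTop (𝓝 0)) →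
      Tendsto (fun n => l (f n)) atTop (𝓝 0))
    (G : ℕ → Set Ω) (hG : ∀ i, IsOpen (G i)) :
    openMass l (⋃ i, G i) ≤ ∑' i, openMass l (G i) := by
  choose g hg0 hgG using fun i => exists_continuousMap_pos_iff (hG i)
  refine iSup₂_le fun f hf => ?_
  set S : ℕ → Ω →ᵇ ℝ := fun k => ∑ i ∈ Finset.range k, unitTrunc (g i) k
  have hSapp : ∀ k ω, S k ω = ∑ i ∈ Finset.range k, unitTrunc (g i) k ω := fun k ω => by
    simp [S]
  have hmono : Monotone fun k => f ⊓ S k := by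
    intro a b hab
    refine inf_le_inf_left f fun ω => ?_
    change S a ω ≤ S b ω
    rw [hSapp, hSapp]
    calc ∑ i ∈ Finset.range a, unitTrunc (g i) a ω
        ≤ ∑ i ∈ Finset.range a, unitTrunc (g i) b ω := by
          refine Finset.sum_le_sum fun i _ => ?_
          rw [unitTrunc_apply, unitTrunc_apply]
          have := hg0 i ω
          gcongr
      _ ≤ _ := Finset.sum_le_sum_of_subset_of_nonneg (Finset.range_mono hab)
          fun i _ _ => unitTrunc_nonneg _ _ _
  have hlim : ∀ ω, Tendsto (fun k => (f ⊓ S k) ω) atTop (𝓝 (f ω)) := by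
    intro ω
    refine tendsto_const_nhds.congr' ?_
    by_cases hω : ω ∈ ⋃ i, G i
    · obtain ⟨i, hi⟩ := mem_iUnion.1 hω
      have hgi := (hgG i ω).2 hi
      obtain ⟨K, hK⟩ := exists_nat_ge (1 / g i ω)
      filter_upwards [eventually_ge_atTop K, eventually_gt_atTop i] with k hk hik
      refine (min_eq_left ?_).symm
      have h1 : (1 : ℝ) ≤ k * g i ω := by
        rw [div_le_iff₀ hgi] at hK
        exact hK.trans (by gcongr)
      refine (hf.2.1 ω).trans ?_
      rw [hSapp]
      refine le_trans ?_ (Finset.single_le_sum (f := fun i => unitTrunc (g i) k ω)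
        (fun i _ => unitTrunc_nonneg _ _ _) (Finset.mem_range.2 hik))
      simp only [unitTrunc_apply]
      rw [min_eq_left h1]
      exact le_max_right _ _
    · filter_upwards with k
      refine (min_eq_left ?_).symm
      rw [hf.2.2 ω hω, hSapp]
      exact Finset.sum_nonneg fun i _ => unitTrunc_nonneg _ _ _
  refine le_of_tendsto (ENNReal.tendsto_ofReal (tendsto_map_of_monotone hreg hmono hlim))
    (Eventually.of_forall fun k => ?_)
  calc ENNReal.ofReal (l (f ⊓ S k)) ≤ ENNReal.ofReal (∑ i ∈ Finset.range k, l (unitTrunc (g i) k)) := by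
        rw [← map_sum]
        exact ENNReal.ofReal_le_ofReal (map_mono_of_pos hpos inf_le_right)
    _ = ∑ i ∈ Finset.range k, ENNReal.ofReal (l (unitTrunc (g i) k)) :=
        ENNReal.ofReal_sum_of_nonneg fun i _ => hpos _ fun ω => unitTrunc_nonneg _ _ ω
    _ ≤ ∑ i ∈ Finset.range k, openMass l (G i) := by
        refine Finset.sum_le_sum fun i _ => ofReal_le_openMass
          ⟨unitTrunc_nonneg _ _, unitTrunc_le_one _ _, fun ω hω => ?_⟩
        have : g i ω = 0 := le_antisymm (not_lt.1 fun h => hω ((hgG i ω).1 h)) (hg0 i ω)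
        simp [unitTrunc_apply, this]
    _ ≤ _ := ENNReal.sum_le_tsum _

/-- The outer measure generated by `openMass`. -/
noncomputable def daniellOuterMeasure (l : (Ω →ᵇ ℝ) →ₗ[ℝ] ℝ) : OuterMeasure Ω :=
  inducedOuterMeasure (P := IsOpen) (fun G _ => openMass l G) isOpen_empty openMass_empty

lemma daniellOuterMeasure_isOpen [TopologicalSpace.PseudoMetrizableSpace Ω]
    (hpos : ∀ f : Ω →ᵇ ℝ, 0 ≤ f → 0 ≤ l f)
    (hreg : ∀ f : ℕ → Ω →ᵇ ℝ, Antitone f → (∀ ω, Tendsto (fun n => f n ω) atTop (𝓝 0)) →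
      Tendsto (fun n => l (f n)) atTop (𝓝 0)) {G : Set Ω} (hG : IsOpen G) :
    daniellOuterMeasure l G = openMass l G :=
  inducedOuterMeasure_eq' (P := IsOpen) (fun _ h => isOpen_iUnion h)
    (fun _ hf => openMass_iUnion_le hpos hreg _ hf) (fun _ _ _ _ h => openMass_mono h) hG

/-- It suffices to test on open `G`. Let `f` compete for `G ∩ U`, and let `h` compete for the open
set `V = G ∩ {f < δ}`, which contains `G \ U`. Since `h` lives where `f < δ`, `f + h ≤ 1 + δ`, so
`(f + h) / (1 + δ)` competes for `G`; then `δ → 0`. -/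
lemma isCaratheodory_daniellOuterMeasure [TopologicalSpace.PseudoMetrizableSpace Ω]
    (hpos : ∀ f : Ω →ᵇ ℝ, 0 ≤ f → 0 ≤ l f)
    (hreg : ∀ f : ℕ → Ω →ᵇ ℝ, Antitone f → (∀ ω, Tendsto (fun n => f n ω) atTop (𝓝 0)) →
      Tendsto (fun n => l (f n)) atTop (𝓝 0)) {U : Set Ω} (hU : IsOpen U) :
    MeasurableSet[(daniellOuterMeasure l).caratheodory] U := by
  refine (inducedOuterMeasure_caratheodory (P := IsOpen) (m0 := openMass_empty)
    (fun _ h => isOpen_iUnion h)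
    (fun _ hf => openMass_iUnion_le hpos hreg _ hf) (fun _ _ _ _ h => openMass_mono h) U).2 ?_
  intro G hG
  change daniellOuterMeasure l (G ∩ U) + daniellOuterMeasure l (G \ U) ≤ daniellOuterMeasure l G
  rw [daniellOuterMeasure_isOpen hpos hreg (hG.inter hU), daniellOuterMeasure_isOpen hpos hreg hG]
  rw [openMass, ENNReal.biSup_add (unitFunctions_nonempty _)]
  refine iSup₂_le fun f hf => ?_
  have hδ : ∀ δ : ℝ, 0 < δ → ENNReal.ofReal (l f) + daniellOuterMeasure l (G \ U) ≤
      ENNReal.ofReal (1 + δ) * openMass l G := by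
    intro δ hδ
    set V : Set Ω := G ∩ {ω | f ω < δ} with hV
    have hVo : IsOpen V := hG.inter (isOpen_lt f.continuous continuous_const)
    have hsub : G \ U ⊆ V := fun ω hω => ⟨hω.1, by
      rw [mem_ofPred_eq, hf.2.2 ω fun h => hω.2 h.2]; exact hδ⟩
    refine (add_le_add_right (measure_mono hsub) _).trans ?_
    rw [daniellOuterMeasure_isOpen hpos hreg hVo, openMass,
      ENNReal.add_biSup (unitFunctions_nonempty _)]
    refine iSup₂_le fun h hh => ?_
    have hmem : (1 + δ)⁻¹ • (f + h) ∈ unitFunctions G := by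
      have hδ' : (0 : ℝ) < 1 + δ := by positivity
      refine ⟨fun ω => ?_, fun ω => ?_, fun ω hω => ?_⟩
      · exact mul_nonneg (by positivity) (add_nonneg (hf.1 ω) (hh.1 ω))
      · change (1 + δ)⁻¹ * (f ω + h ω) ≤ 1
        rw [inv_mul_le_iff₀ hδ', mul_one]
        by_cases hω : ω ∈ V
        · have := hω.2
          rw [mem_ofPred_eq] at this
          linarith [hh.2.1 ω]
        · linarith [hh.2.2 ω hω, hf.2.1 ω]
      · change (1 + δ)⁻¹ * (f ω + h ω) = 0
        rw [hf.2.2 ω fun h => hω h.1, hh.2.2 ω fun h => hω h.1]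
        simp
    have := ofReal_le_openMass (l := l) hmem
    rw [map_smul, smul_eq_mul, map_add] at this
    calc ENNReal.ofReal (l f) + ENNReal.ofReal (l h) = ENNReal.ofReal (l f + l h) :=
          (ENNReal.ofReal_add (hpos _ hf.1) (hpos _ hh.1)).symm
      _ = ENNReal.ofReal (1 + δ) * ENNReal.ofReal ((1 + δ)⁻¹ * (l f + l h)) := by
          rw [← ENNReal.ofReal_mul (by positivity)]
          congr 1
          field_simp
      _ ≤ _ := by gcongr
  have hlim : Tendsto (fun δ : ℝ => ENNReal.ofReal (1 + δ) * openMass l G) (𝓝[>] 0)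
      (𝓝 (ENNReal.ofReal (1 + 0) * openMass l G)) := by
    refine ENNReal.Tendsto.mul_const ?_ (Or.inl (by simp))
    refine ENNReal.tendsto_ofReal ?_
    exact ((continuous_const.add continuous_id).tendsto (0 : ℝ)).mono_left nhdsWithin_le_nhds
  rw [add_zero, ENNReal.ofReal_one, one_mul] at hlim
  exact ge_of_tendsto hlim (eventually_nhdsWithin_of_forall hδ)

/-- The layer-cake decomposition of `x` into slices of height one. -/
lemma sum_range_clamp {x : ℝ} (hx : 0 ≤ x) (n : ℕ) :
    ∑ k ∈ Finset.range n, max 0 (min 1 (x - k)) = min x n := by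
  induction n with
  | zero => simp [hx]
  | succ n ih =>
    rw [Finset.sum_range_succ, ih]
    push_cast
    rcases le_total x n with h | h
    · rw [min_eq_left h, min_eq_right (by linarith), max_eq_left (by linarith),
        min_eq_left (by linarith), add_zero]
    · rw [min_eq_right h, max_eq_right (le_min zero_le_one (by linarith)), add_comm,
        ← min_add_add_right, sub_add_cancel, add_comm, min_comm]

lemma sum_range_ite_lt_le {x : ℝ} (hx : 0 ≤ x) (n : ℕ) :
    ∑ k ∈ Finset.range n, (if (k : ℝ) < x then (1 : ℝ) else 0) ≤ min (x + 1) n := by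
  induction n with
  | zero => simp; linarith
  | succ n ih =>
    rw [Finset.sum_range_succ]
    push_cast
    have h1 := ih.trans (min_le_left _ _)
    have h2 := ih.trans (min_le_right _ _)
    split_ifs with h
    · exact le_min (by linarith) (by linarith)
    · exact le_min (by linarith) (by linarith)

/-- A regular positive normalized linear form on bounded continuous functions is the integral
with respect to a Borel probability measure. -/
theorem exists_probabilityMeasure_integral_eq [TopologicalSpace.PseudoMetrizableSpace Ω]
    [MeasurableSpace Ω] [BorelSpace Ω]
    (hpos : ∀ f : Ω →ᵇ ℝ, 0 ≤ f → 0 ≤ l f) (h1 : l 1 = 1)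
    (hreg : ∀ f : ℕ → Ω →ᵇ ℝ, Antitone f → (∀ ω, Tendsto (fun n => f n ω) atTop (𝓝 0)) →
      Tendsto (fun n => l (f n)) atTop (𝓝 0)) :
    ∃ Q : ProbabilityMeasure Ω, ∀ f : Ω →ᵇ ℝ, ∫ ω, f ω ∂(Q : Measure Ω) = l f := by
  have hle : ‹MeasurableSpace Ω› ≤ (daniellOuterMeasure l).caratheodory := by
    rw [BorelSpace.measurable_eq (α := Ω)]
    exact MeasurableSpace.generateFrom_le fun U hU =>
      isCaratheodory_daniellOuterMeasure hpos hreg hU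
  set Q : Measure Ω := (daniellOuterMeasure l).toMeasure hle with hQ
  have hQo : ∀ G, IsOpen G → Q G = openMass l G := fun G hG => by
    rw [hQ, toMeasure_apply _ hle hG.measurableSet, daniellOuterMeasure_isOpen hpos hreg hG]
  have : IsProbabilityMeasure Q := ⟨by rw [hQo _ isOpen_univ, openMass_univ hpos h1]⟩
  have hint : ∀ f : Ω →ᵇ ℝ, Integrable f Q := fun f => f.integrable Q
  have hle' : ∀ f : Ω →ᵇ ℝ, (∀ ω, 0 ≤ f ω) → (∀ ω, f ω ≤ 1) → l f ≤ ∫ ω, f ω ∂Q := by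
    intro f hf0 hf1
    -- Cut `n • f` into `n` slices of height one. Each slice competes for the open set where it is
    -- positive, and at each point the number of such sets is at most `n * f + 1`. Dividing by `n`
    -- removes the error `1`.
    have hn : ∀ n : ℕ, (n : ℝ) * l f ≤ n * (∫ ω, f ω ∂Q) + 1 := by
      intro n
      set F : ℕ → Ω →ᵇ ℝ := fun k =>
        unitTrunc ⟨fun ω => n * f ω - k, by fun_prop⟩ 1
      have hFapp : ∀ k ω, F k ω = max 0 (min 1 (n * f ω - k)) := fun k ω => by
        simp [F, unitTrunc_apply]
      have hsum : (n : ℝ) • f = ∑ k ∈ Finset.range n, F k := by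
        ext ω
        simp only [BoundedContinuousFunction.coe_sum, Finset.sum_apply, hFapp]
        rw [sum_range_clamp (mul_nonneg n.cast_nonneg (hf0 ω)),
          min_eq_left (mul_le_of_le_one_right n.cast_nonneg (hf1 ω))]
        rfl
      have hG : ∀ k : ℕ, MeasurableSet {ω | (k : ℝ) < n * f ω} := fun k =>
        (isOpen_lt continuous_const (by fun_prop)).measurableSet
      have hF : ∀ k, l (F k) ≤ Q.real {ω | (k : ℝ) < n * f ω} := by
        intro k
        rw [Measure.real, ← ENNReal.ofReal_le_iff_le_toReal (measure_ne_top _ _),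
          hQo _ (isOpen_lt continuous_const (by fun_prop))]
        refine ofReal_le_openMass ⟨unitTrunc_nonneg _ _, unitTrunc_le_one _ _, fun ω hω => ?_⟩
        rw [mem_ofPred_eq, not_lt] at hω
        rw [hFapp]
        exact max_eq_left ((min_le_right _ _).trans (by linarith))
      have hind : ∀ k : ℕ, Integrable ({ω | (k : ℝ) < n * f ω}.indicator fun _ => (1 : ℝ)) Q :=
        fun k => (integrable_const _).indicator (hG k)
      calc (n : ℝ) * l f = ∑ k ∈ Finset.range n, l (F k) := by
            rw [← smul_eq_mul, ← map_smul, hsum, map_sum]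
        _ ≤ ∑ k ∈ Finset.range n, ∫ ω, {ω | (k : ℝ) < n * f ω}.indicator (fun _ => (1 : ℝ)) ω ∂Q := by
            refine Finset.sum_le_sum fun k _ => (hF k).trans_eq ?_
            rw [integral_indicator (hG k)]
            simp
        _ = ∫ ω, ∑ k ∈ Finset.range n, {ω | (k : ℝ) < n * f ω}.indicator (fun _ => (1 : ℝ)) ω ∂Q :=
            (integral_finsetSum _ fun k _ => hind k).symm
        _ ≤ ∫ ω, (n * f ω + 1) ∂Q := by
            refine integral_mono (integrable_finsetSum _ fun k _ => hind k)
              (((hint f).const_mul _).add (integrable_const _)) fun ω => ?_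
            refine le_trans (le_of_eq ?_) ((sum_range_ite_lt_le
              (mul_nonneg n.cast_nonneg (hf0 ω)) n).trans (min_le_left _ _))
            refine Finset.sum_congr rfl fun k _ => ?_
            simp only [indicator_apply, mem_ofPred_eq]
        _ = n * (∫ ω, f ω ∂Q) + 1 := by
            rw [integral_add ((hint f).const_mul _) (integrable_const _), integral_const_mul]
            simp
    by_contra! hlt
    obtain ⟨n, hn'⟩ := exists_nat_gt (1 / (l f - ∫ ω, f ω ∂Q))
    rw [div_lt_iff₀ (by linarith)] at hn'
    linarith [hn n]
  have hscale : ∀ f : Ω →ᵇ ℝ, (∀ ω, 0 ≤ f ω) → (∀ ω, f ω ≤ 1) → ∫ ω, f ω ∂Q = l f := by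
    intro f hf0 hf1
    refine le_antisymm ?_ (hle' f hf0 hf1)
    -- The reverse inequality is the same one for `1 - f`, as both functionals give mass one to
    -- constants.
    have := hle' (1 - f) (fun ω => sub_nonneg.2 (hf1 ω)) (fun ω => sub_le_self _ (hf0 ω))
    rw [map_sub, h1] at this
    have h2 : ∫ ω, (1 - f) ω ∂Q = 1 - ∫ ω, f ω ∂Q := by
      change ∫ ω, (1 - f ω) ∂Q = _
      rw [integral_sub (integrable_const _) (hint f)]
      simp
    linarith
  refine ⟨⟨Q, this⟩, fun f => ?_⟩
  change ∫ ω, f ω ∂Q = l f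
  set c : ℝ := 2 * ‖f‖ + 1
  have hc : 0 < c := by positivity
  -- An affine change brings `f` into `[0, 1]`; the `+ 1` in `c` keeps it positive when `f = 0`.
  have hf : f = c • (c⁻¹ • (f + ‖f‖ • 1)) - ‖f‖ • (1 : Ω →ᵇ ℝ) := by
    rw [smul_smul, mul_inv_cancel₀ hc.ne', one_smul, add_sub_cancel_right]
  have key := hscale (c⁻¹ • (f + ‖f‖ • 1)) (fun ω => ?_) fun ω => ?_
  · rw [hf, map_sub, map_smul, ← key, map_smul, h1]
    change ∫ ω, (c * (c⁻¹ • (f + ‖f‖ • 1)) ω - ‖f‖ * 1) ∂Q = _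
    rw [integral_sub ((hint _).const_mul _) (integrable_const _), integral_const_mul]
    simp
  all_goals
    have h2 := (Real.norm_eq_abs _ ▸ f.norm_coe_le_norm ω : |f ω| ≤ ‖f‖)
    rw [abs_le] at h2
    change _ ≤ _
    simp only [BoundedContinuousFunction.coe_smul, BoundedContinuousFunction.coe_add, Pi.add_apply,
      BoundedContinuousFunction.coe_one, Pi.one_apply, smul_eq_mul, mul_one]
  · exact mul_nonneg (by positivity) (by linarith)
  · rw [inv_mul_le_iff₀ hc]
    simp only [c]
    linarith

end Daniell

/-! ## The Banach lattice `L¹(c_ρ)` -/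

namespace RegularSublinearRiskMeasure

section Lattice

variable {Ω : Type*} [TopologicalSpace Ω] (ρ : RegularSublinearRiskMeasure Ω)

lemma norm_toL1c (f : Ω →ᵇ ℝ) : ‖ρ.toL1c f‖ = ρ.capacity f := Completion.norm_coe _

lemma toL1c_add (f g : Ω →ᵇ ℝ) : ρ.toL1c (f + g) = ρ.toL1c f + ρ.toL1c g := Completion.coe_add _ _

lemma toL1c_neg (f : Ω →ᵇ ℝ) : ρ.toL1c (-f) = -ρ.toL1c f := Completion.coe_neg _

lemma toL1c_sub (f g : Ω →ᵇ ℝ) : ρ.toL1c (f - g) = ρ.toL1c f - ρ.toL1c g := Completion.coe_sub _ _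

lemma toL1c_smul (a : ℝ) (f : Ω →ᵇ ℝ) : ρ.toL1c (a • f) = a • ρ.toL1c f :=
  (Completion.toComplL (𝕜 := ℝ) (E := ρ.CbSeminormed)).map_smul a (ρ.toCb.symm f)

lemma induction_toL1c {p : ρ.L1c → Prop} (X : ρ.L1c) (hp : IsClosed {X | p X})
    (h : ∀ f, p (ρ.toL1c f)) : p X :=
  Completion.induction_on X hp h

/-- The cone of non negative elements of `L¹(c_ρ)`. -/
def posCone : Set ρ.L1c := closure (ρ.toL1c '' {f | 0 ≤ f})

lemma isClosed_posCone : IsClosed ρ.posCone := isClosed_closure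

lemma leL1c_iff {X Y : ρ.L1c} : ρ.LeL1c X Y ↔ Y - X ∈ ρ.posCone := Iff.rfl

lemma toL1c_mem_posCone {f : Ω →ᵇ ℝ} (hf : 0 ≤ f) : ρ.toL1c f ∈ ρ.posCone :=
  subset_closure ⟨f, hf, rfl⟩

lemma zero_mem_posCone : (0 : ρ.L1c) ∈ ρ.posCone := ρ.toL1c_mem_posCone le_rfl

lemma add_mem_posCone {X Y : ρ.L1c} (hX : X ∈ ρ.posCone) (hY : Y ∈ ρ.posCone) :
    X + Y ∈ ρ.posCone := by
  refine map_mem_closure₂ continuous_add hX hY ?_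
  rintro _ ⟨f, hf, rfl⟩ _ ⟨g, hg, rfl⟩
  exact ⟨f + g, add_nonneg (show 0 ≤ f from hf) hg, ρ.toL1c_add f g⟩

lemma smul_mem_posCone {a : ℝ} (ha : 0 ≤ a) {X : ρ.L1c} (hX : X ∈ ρ.posCone) :
    a • X ∈ ρ.posCone := by
  refine map_mem_closure (continuous_const_smul a) hX ?_
  rintro _ ⟨f, hf, rfl⟩
  exact ⟨a • f, fun ω => mul_nonneg ha (hf ω), ρ.toL1c_smul a f⟩

lemma sum_mem_posCone {ι : Type*} (s : Finset ι) {X : ι → ρ.L1c} (hX : ∀ i, X i ∈ ρ.posCone) :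
    ∑ i ∈ s, X i ∈ ρ.posCone :=
  Finset.sum_induction _ (· ∈ ρ.posCone) (fun _ _ => ρ.add_mem_posCone) ρ.zero_mem_posCone
    fun i _ => hX i

lemma leL1c_trans {X Y Z : ρ.L1c} (h : ρ.LeL1c X Y) (h' : ρ.LeL1c Y Z) : ρ.LeL1c X Z := by
  have := ρ.add_mem_posCone h' h
  rwa [sub_add_sub_cancel] at this

lemma lipschitzWith_abs :
    LipschitzWith 1 fun f : ρ.CbSeminormed => ρ.toCb.symm |ρ.toCb f| := by
  refine LipschitzWith.of_dist_le_mul fun f g => ?_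
  rw [dist_eq_norm, dist_eq_norm, NNReal.coe_one, one_mul]
  refine ρ.capacity_mono fun ω => ?_
  exact abs_abs_sub_abs_le (ρ.toCb f ω) (ρ.toCb g ω)

/-- The absolute value on `L¹(c_ρ)`. -/
noncomputable def absL : ρ.L1c → ρ.L1c :=
  Completion.map fun f : ρ.CbSeminormed => ρ.toCb.symm |ρ.toCb f|

lemma continuous_absL : Continuous ρ.absL := Completion.continuous_map

lemma absL_toL1c (f : Ω →ᵇ ℝ) : ρ.absL (ρ.toL1c f) = ρ.toL1c |f| :=
  Completion.map_coe ρ.lipschitzWith_abs.uniformContinuous _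

lemma norm_absL (X : ρ.L1c) : ‖ρ.absL X‖ = ‖X‖ := by
  refine ρ.induction_toL1c X (isClosed_eq ρ.continuous_absL.norm continuous_norm) fun f => ?_
  rw [absL_toL1c, norm_toL1c, norm_toL1c, capacity, capacity, abs_abs]

lemma absL_mem_posCone (X : ρ.L1c) : ρ.absL X ∈ ρ.posCone := by
  refine ρ.induction_toL1c X (ρ.isClosed_posCone.preimage ρ.continuous_absL) fun f => ?_
  rw [absL_toL1c]
  exact ρ.toL1c_mem_posCone (abs_nonneg f)

lemma leL1c_absL (X : ρ.L1c) : ρ.LeL1c X (ρ.absL X) := by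
  refine ρ.induction_toL1c X (ρ.isClosed_posCone.preimage (ρ.continuous_absL.sub continuous_id))
    fun f => ?_
  change ρ.absL (ρ.toL1c f) - ρ.toL1c f ∈ _
  rw [absL_toL1c, ← toL1c_sub]
  exact ρ.toL1c_mem_posCone (sub_nonneg.2 (le_abs_self f))

lemma leL1c_tsum {X : ℕ → ρ.L1c} (hX : ∀ i, X i ∈ ρ.posCone) (hs : Summable X) (k : ℕ) :
    ρ.LeL1c (X k) (∑' i, X i) := by
  refine ρ.isClosed_posCone.mem_of_tendsto (hs.hasSum.tendsto_sum_nat.sub_const (X k)) ?_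
  filter_upwards [eventually_gt_atTop k] with n hn
  rw [← Finset.sum_erase_eq_sub (Finset.mem_range.2 hn)]
  exact ρ.sum_mem_posCone _ hX

/-- A monotone sublinear functional that agrees with the norm on non negative bounded continuous
functions agrees with the norm on the whole positive cone. -/
lemma eq_norm_of_sublinear {F : ρ.L1c → ℝ} (hmono : ∀ X Y, ρ.LeL1c X Y → F X ≤ F Y)
    (hadd : ∀ X Y, F (X + Y) ≤ F X + F Y) (hsmul : ∀ (a : ℝ) X, 0 ≤ a → F (a • X) = a * F X)
    (hF : ∀ f : Ω →ᵇ ℝ, 0 ≤ f → F (ρ.toL1c f) = ‖ρ.toL1c f‖) {W : ρ.L1c}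
    (hW : W ∈ ρ.posCone) : F W = ‖W‖ := by
  have hf : ∀ k : ℕ, ∃ f : Ω →ᵇ ℝ, 0 ≤ f ∧ ‖W - ρ.toL1c f‖ < (1 / 4) ^ k := by
    intro k
    obtain ⟨_, ⟨f, hf, rfl⟩, h⟩ := Metric.mem_closure_iff.1 hW ((1 / 4) ^ k) (by positivity)
    -- The rate `(1 / 4) ^ k` leaves the errors summable after multiplication by `2 ^ k`.
    exact ⟨f, hf, by rwa [← dist_eq_norm]⟩
  choose f hf0 hf using hf
  set A : ℕ → ρ.L1c := fun k => (2 : ℝ) ^ k • ρ.absL (W - ρ.toL1c (f k)) with hA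
  have hApos : ∀ k, A k ∈ ρ.posCone := fun k =>
    ρ.smul_mem_posCone (by positivity) (ρ.absL_mem_posCone _)
  have hAs : Summable A := by
    refine Summable.of_norm_bounded (g := fun k => (1 / 2 : ℝ) ^ k) summable_geometric_two
      fun k => ?_
    rw [hA, norm_smul, norm_absL, Real.norm_of_nonneg (by positivity)]
    calc (2 : ℝ) ^ k * ‖W - ρ.toL1c (f k)‖ ≤ 2 ^ k * (1 / 4) ^ k := by
          gcongr; exact (hf k).le
      _ = (1 / 2) ^ k := by rw [← mul_pow]; norm_num
  set V := ∑' k, A k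
  -- This replaces continuity of `F`: all the errors `2 ^ k • Z` lie below the single element `V`,
  -- so monotonicity and homogeneity force `F Z` to be small.
  have hsmall : ∀ k Z, ρ.absL Z = ρ.absL (W - ρ.toL1c (f k)) → F Z ≤ (1 / 2) ^ k * F V := by
    intro k Z hZ
    have h1 : ρ.LeL1c ((2 : ℝ) ^ k • Z) V := by
      refine ρ.leL1c_trans (Y := A k) ?_ (ρ.leL1c_tsum hApos hAs k)
      rw [leL1c_iff, hA]
      simp only
      rw [← hZ, ← smul_sub]
      exact ρ.smul_mem_posCone (by positivity) (ρ.leL1c_absL Z)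
    have h2 := hmono _ _ h1
    rw [hsmul _ _ (by positivity)] at h2
    calc F Z = (1 / 2) ^ k * (2 ^ k * F Z) := by
          rw [← mul_assoc, ← mul_pow]; norm_num
      _ ≤ _ := by gcongr
  have habs : ∀ X : ρ.L1c, ρ.absL (-X) = ρ.absL X := fun X => by
    refine ρ.induction_toL1c X (isClosed_eq (ρ.continuous_absL.comp continuous_neg)
      ρ.continuous_absL) fun g => ?_
    change ρ.absL (-ρ.toL1c g) = _
    rw [← toL1c_neg, absL_toL1c, absL_toL1c, abs_neg]
  have hpow : Tendsto (fun k : ℕ => (1 / 2 : ℝ) ^ k) atTop (𝓝 0) :=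
    tendsto_pow_atTop_nhds_zero_of_lt_one (by norm_num) (by norm_num)
  have hlim : Tendsto (fun k => ‖ρ.toL1c (f k)‖) atTop (𝓝 ‖W‖) := by
    refine Tendsto.norm (tendsto_iff_norm_sub_tendsto_zero.2 ?_)
    refine squeeze_zero (fun _ => norm_nonneg _) (fun k => ?_)
      (tendsto_pow_atTop_nhds_zero_of_lt_one (r := (1 / 4 : ℝ)) (by norm_num) (by norm_num))
    rw [norm_sub_rev]
    exact (hf k).le
  have hV : Tendsto (fun k : ℕ => (1 / 2 : ℝ) ^ k * F V) atTop (𝓝 0) := by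
    simpa using hpow.mul_const (F V)
  refine le_antisymm ?_ ?_
  · refine ge_of_tendsto' (f := fun k => ‖ρ.toL1c (f k)‖ + (1 / 2 : ℝ) ^ k * F V)
      (by simpa using hlim.add hV) fun k => ?_
    have := hadd (ρ.toL1c (f k)) (W - ρ.toL1c (f k))
    rw [add_sub_cancel, hF _ (hf0 k)] at this
    linarith [hsmall k _ rfl]
  · refine le_of_tendsto' (f := fun k => ‖ρ.toL1c (f k)‖ - (1 / 2 : ℝ) ^ k * F V)
      (by simpa using hlim.sub hV) fun k => ?_
    have := hadd W (ρ.toL1c (f k) - W)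
    rw [add_sub_cancel, hF _ (hf0 k)] at this
    have h3 := hsmall k (ρ.toL1c (f k) - W) (by rw [← habs, neg_sub])
    linarith

end Lattice

section Expectation

variable {Ω : Type*} [TopologicalSpace Ω] (ρ : RegularSublinearRiskMeasure Ω)
variable [MeasurableSpace Ω] [BorelSpace Ω] {Q : ProbabilityMeasure Ω}

lemma continuous_toLp : Continuous (ρ.toLp Q) := Completion.continuous_extension

lemma toLp_add (hQ : ρ.MemDualBall Q) (X Y : ρ.L1c) :
    ρ.toLp Q (X + Y) = ρ.toLp Q X + ρ.toLp Q Y := by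
  have hc := ρ.continuous_toLp (Q := Q)
  refine Completion.induction_on₂ X Y (isClosed_eq (hc.comp continuous_add)
    ((hc.comp continuous_fst).add (hc.comp continuous_snd))) fun f g => ?_
  change ρ.toLp Q (ρ.toL1c (ρ.toCb f) + ρ.toL1c (ρ.toCb g)) =
    ρ.toLp Q (ρ.toL1c (ρ.toCb f)) + ρ.toLp Q (ρ.toL1c (ρ.toCb g))
  rw [← toL1c_add, toLp_toL1c _ hQ, toLp_toL1c _ hQ, toLp_toL1c _ hQ, map_add]

lemma toLp_smul (hQ : ρ.MemDualBall Q) (a : ℝ) (X : ρ.L1c) :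
    ρ.toLp Q (a • X) = a • ρ.toLp Q X := by
  have hc := ρ.continuous_toLp (Q := Q)
  refine ρ.induction_toL1c X (isClosed_eq (hc.comp (continuous_const_smul a))
    (hc.const_smul a)) fun f => ?_
  change ρ.toLp Q (a • ρ.toL1c f) = a • ρ.toLp Q (ρ.toL1c f)
  rw [← toL1c_smul, toLp_toL1c _ hQ, toLp_toL1c _ hQ, map_smul]

lemma toLp_neg (hQ : ρ.MemDualBall Q) (X : ρ.L1c) : ρ.toLp Q (-X) = -ρ.toLp Q X := by
  have := ρ.toLp_smul hQ (-1) X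
  rwa [neg_one_smul, neg_one_smul] at this

lemma toLp_nonneg (hQ : ρ.MemDualBall Q) {X : ρ.L1c} (hX : X ∈ ρ.posCone) :
    0 ≤ ρ.toLp Q X := by
  have hcl : IsClosed {X | 0 ≤ ρ.toLp Q X} := isClosed_le continuous_const ρ.continuous_toLp
  refine closure_minimal ?_ hcl hX
  rintro _ ⟨f, hf, rfl⟩
  rw [mem_ofPred_eq, toLp_toL1c _ hQ, ← Lp.coeFn_nonneg]
  filter_upwards [BoundedContinuousFunction.coeFn_toLp (p := 1) (Q : Measure Ω) ℝ f] with ω hω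
  rw [hω]
  exact hf ω

/-- The expectation under `Q` of an element of `L¹(c_ρ)`. -/
noncomputable def expect (Q : ProbabilityMeasure Ω) (X : ρ.L1c) : ℝ :=
  ∫ ω, ρ.toLp Q X ω ∂(Q : Measure Ω)

lemma continuous_expect : Continuous (ρ.expect Q) :=
  continuous_integral.comp ρ.continuous_toLp

lemma expect_toL1c (hQ : ρ.MemDualBall Q) (f : Ω →ᵇ ℝ) :
    ρ.expect Q (ρ.toL1c f) = ∫ ω, f ω ∂(Q : Measure Ω) := by
  rw [expect, toLp_toL1c _ hQ]
  exact integral_congr_ae (BoundedContinuousFunction.coeFn_toLp (p := 1) (Q : Measure Ω) ℝ f)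

lemma expect_add (hQ : ρ.MemDualBall Q) (X Y : ρ.L1c) :
    ρ.expect Q (X + Y) = ρ.expect Q X + ρ.expect Q Y := by
  rw [expect, toLp_add _ hQ, integral_congr_ae (Lp.coeFn_add _ _)]
  exact integral_add (L1.integrable_coeFn _) (L1.integrable_coeFn _)

lemma expect_neg (hQ : ρ.MemDualBall Q) (X : ρ.L1c) :
    ρ.expect Q (-X) = -ρ.expect Q X := by
  rw [expect, toLp_neg _ hQ, integral_congr_ae (Lp.coeFn_neg _)]
  exact integral_neg _

lemma expect_sub (hQ : ρ.MemDualBall Q) (X Y : ρ.L1c) :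
    ρ.expect Q (X - Y) = ρ.expect Q X - ρ.expect Q Y := by
  rw [sub_eq_add_neg, expect_add _ hQ, expect_neg _ hQ, sub_eq_add_neg]

lemma expect_smul (hQ : ρ.MemDualBall Q) (a : ℝ) (X : ρ.L1c) :
    ρ.expect Q (a • X) = a * ρ.expect Q X := by
  rw [expect, toLp_smul _ hQ, integral_congr_ae (Lp.coeFn_smul _ _)]
  exact integral_const_mul _ _

lemma expect_mono (hQ : ρ.MemDualBall Q) {X Y : ρ.L1c} (h : ρ.LeL1c X Y) :
    ρ.expect Q X ≤ ρ.expect Q Y := by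
  have h1 := ρ.toLp_nonneg hQ h
  have h2 : 0 ≤ ρ.expect Q (Y - X) := integral_nonneg_of_ae ((Lp.coeFn_nonneg _).2 h1)
  rw [expect_sub _ hQ] at h2
  linarith

lemma expect_eq_of_forall {l : ρ.L1c →L[ℝ] ℝ} (hQ : ρ.MemDualBall Q)
    (h : ∀ f : Ω →ᵇ ℝ, l (ρ.toL1c f) = ∫ ω, f ω ∂(Q : Measure Ω)) (X : ρ.L1c) :
    ρ.expect Q X = l X := by
  refine ρ.induction_toL1c X (isClosed_eq ρ.continuous_expect l.continuous) fun f => ?_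
  rw [h, expect_toL1c _ hQ]

lemma expect_le_norm (hQ : ρ.MemDualBall Q) (X : ρ.L1c) : ρ.expect Q X ≤ ‖X‖ := by
  obtain ⟨l, hl, h⟩ := id hQ
  rw [ρ.expect_eq_of_forall hQ h]
  exact (le_abs_self _).trans ((l.le_opNorm X).trans (mul_le_of_le_one_left (norm_nonneg _) hl))

lemma integrable_mul_toLp (f : Ω →ᵇ ℝ) (A : Lp ℝ 1 (Q : Measure Ω)) :
    Integrable (fun ω => f ω * A ω) (Q : Measure Ω) :=
  (L1.integrable_coeFn A).bdd_mul f.continuous.aestronglyMeasurable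
    (Eventually.of_forall f.norm_coe_le_norm)

lemma continuous_integral_mul (f : Ω →ᵇ ℝ) :
    Continuous fun A : Lp ℝ 1 (Q : Measure Ω) => ∫ ω, f ω * A ω ∂(Q : Measure Ω) := by
  refine (LipschitzWith.of_dist_le_mul (K := ‖f‖₊) fun A B => ?_).continuous
  rw [dist_eq_norm, dist_eq_norm, ← integral_sub (integrable_mul_toLp f A)
    (integrable_mul_toLp f B), L1.norm_eq_integral_norm, coe_nnnorm, ← integral_const_mul]
  refine (norm_integral_le_integral_norm _).trans (integral_mono_ae
    ((integrable_mul_toLp f A).sub (integrable_mul_toLp f B)).norm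
    ((L1.integrable_coeFn _).norm.const_mul _) ?_)
  filter_upwards [Lp.coeFn_sub A B] with ω hω
  rw [hω, Pi.sub_apply, ← mul_sub, norm_mul]
  gcongr
  exact f.norm_coe_le_norm ω

lemma expect_mulL1c (hQ : ρ.MemDualBall Q) (f : Ω →ᵇ ℝ) (X : ρ.L1c) :
    ρ.expect Q (ρ.mulL1c f X) = ∫ ω, f ω * ρ.toLp Q X ω ∂(Q : Measure Ω) := by
  refine ρ.induction_toL1c X (isClosed_eq (ρ.continuous_expect.comp (ρ.mulL1c f).continuous)
    ((continuous_integral_mul f).comp ρ.continuous_toLp)) fun g => ?_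
  change ρ.expect Q (ρ.mulL1c f (ρ.toL1c g)) = ∫ ω, f ω * ρ.toLp Q (ρ.toL1c g) ω ∂(Q : Measure Ω)
  rw [mulL1c_toL1c, expect_toL1c _ hQ, toLp_toL1c _ hQ]
  refine integral_congr_ae ?_
  filter_upwards [BoundedContinuousFunction.coeFn_toLp (p := 1) (Q : Measure Ω) ℝ g] with ω hω
  rw [hω]
  rfl

end Expectation

end RegularSublinearRiskMeasure

/-! ### Hahn–Banach for sublinear functionals -/

/-- A sublinear functional is attained at every point by a dominated linear form. -/
lemma exists_linearMap_le_sublinear {V : Type*} [AddCommGroup V] [Module ℝ V] (N : V → ℝ)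
    (hsmul : ∀ (a : ℝ) x, 0 ≤ a → N (a • x) = a * N x) (hadd : ∀ x y, N (x + y) ≤ N x + N y)
    (x₀ : V) : ∃ g : V →ₗ[ℝ] ℝ, g x₀ = N x₀ ∧ ∀ x, g x ≤ N x := by
  have h0 : N 0 = 0 := by simpa using hsmul 0 0 le_rfl
  have H : ∀ c : ℝ, c • x₀ = 0 → c • N x₀ = 0 := fun c hc => by
    rcases smul_eq_zero.1 hc with h | h
    · rw [h, zero_smul]
    · rw [h, h0, smul_zero]
  obtain ⟨g, hgp, hg⟩ := exists_extension_of_le_sublinear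
    (LinearPMap.mkSpanSingleton' (σ := RingHom.id ℝ) x₀ (N x₀) H) N (fun c hc x => hsmul c x hc.le)
    hadd (by
      rintro ⟨x, hx⟩
      obtain ⟨c, rfl⟩ := Submodule.mem_span_singleton.1 hx
      rw [LinearPMap.mkSpanSingleton'_apply, RingHom.id_apply, smul_eq_mul]
      rcases le_total 0 c with hc | hc
      · exact (hsmul c x₀ hc).ge
      · have h1 := hsmul (-c) (-x₀) (neg_nonneg.2 hc)
        rw [smul_neg, neg_smul, neg_neg] at h1
        have h2 := hadd x₀ (-x₀)
        rw [add_neg_cancel, h0] at h2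
        change c * N x₀ ≤ N (c • x₀)
        rw [h1]
        nlinarith)
  refine ⟨g, ?_, hg⟩
  exact (hgp ⟨x₀, Submodule.mem_span_singleton_self x₀⟩).trans
    (LinearPMap.mkSpanSingleton'_apply_self x₀ (N x₀) H _)

namespace RegularSublinearRiskMeasure

/-! ## Separability of `L¹(c_ρ)` -/

section Separable

variable {Ω : Type*} [PseudoMetricSpace Ω]

/-- The bounded continuous function `min (q + m * dist · y) M`. -/
noncomputable def distTrunc (y : Ω) (q : ℝ) (m M : ℕ) : Ω →ᵇ ℝ :=
  BoundedContinuousFunction.ofNormedAddCommGroup (fun x => min (q + m * dist x y) M)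
    (by fun_prop) (|q| + M) (fun x => by
      rw [Real.norm_eq_abs, abs_le]
      have h1 : (0 : ℝ) ≤ m * dist x y := by positivity
      have h2 : (0 : ℝ) ≤ M := M.cast_nonneg
      exact ⟨le_min (by linarith [neg_abs_le q]) (by linarith [abs_nonneg q]),
        (min_le_right _ _).trans (by linarith [abs_nonneg q])⟩)

/-- Truncated cones with rational height and integer slope, centred on a dense sequence, form a
countable family of which every `f` is the pointwise infimum from above. -/
lemma exists_distTrunc_le {D : ℕ → Ω} (hD : DenseRange D) (f : Ω →ᵇ ℝ) (x : Ω) {ε : ℝ}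
    (hε : 0 < ε) : ∃ (q : ℚ) (j m M : ℕ), f ≤ distTrunc (D j) q m M ∧
      distTrunc (D j) q m M x ≤ f x + ε := by
  obtain ⟨δ, hδ, hfδ⟩ := Metric.continuous_iff.1 f.continuous x (ε / 3) (by positivity)
  obtain ⟨M, hM⟩ := exists_nat_ge ‖f‖
  -- With this slope a cone of height at least `-‖f‖` exceeds `‖f‖` at distance `δ / 2` from its
  -- centre. The centre is then taken so close to `x` that the cone costs at most `ε / 3` at `x`.
  obtain ⟨m, hm⟩ := exists_nat_ge (2 * ‖f‖ / (δ / 2))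
  obtain ⟨j, hj⟩ := hD.exists_dist_lt x (ε := min (δ / 2) (ε / 3 / (m + 1))) (by positivity)
  obtain ⟨q, hq1, hq2⟩ := exists_rat_btwn (show f x + ε / 3 < f x + 2 * (ε / 3) by linarith)
  have hb : ∀ y, |f y| ≤ ‖f‖ := fun y => f.norm_coe_le_norm y
  have hm0 : (0 : ℝ) ≤ m := m.cast_nonneg
  refine ⟨q, j, m, M, fun y => le_min ?_ ?_, (min_le_left _ _).trans ?_⟩
  · rcases lt_or_ge (dist y x) δ with h | h
    · have := hfδ y h
      rw [Real.dist_eq, abs_lt] at this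
      have h0 : 0 ≤ m * dist y (D j) := by positivity
      change f y ≤ _
      linarith [this.2]
    · have h1 : δ / 2 ≤ dist y (D j) := by
        have := hj.trans_le (min_le_left _ _)
        linarith [dist_triangle_right y x (D j)]
      rw [div_le_iff₀ (by positivity)] at hm
      have h2 : m * (δ / 2) ≤ m * dist y (D j) := by gcongr
      change f y ≤ _
      linarith [(abs_le.1 (hb x)).1, (abs_le.1 (hb y)).2]
  · exact (le_abs_self _).trans ((hb y).trans hM)
  · have h1 := (hj.trans_le (min_le_right _ _)).le
    rw [le_div_iff₀ (by positivity)] at h1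
    have h2 : 0 ≤ dist x (D j) := dist_nonneg
    linarith

/-- Finite infima of a countable family decrease pointwise to any given `f`, and regularity of `ρ`
turns this into convergence for `c_ρ`. Thus the countably many finite infima are dense, although
`C_b(Ω)` need not be separable for the uniform norm. -/
lemma separableSpace_L1c {Ω : Type*} [TopologicalSpace Ω] [SecondCountableTopology Ω]
    [TopologicalSpace.PseudoMetrizableSpace Ω] [Nonempty Ω] (ρ : RegularSublinearRiskMeasure Ω) :
    TopologicalSpace.SeparableSpace ρ.L1c := by
  classical
  let _ := TopologicalSpace.pseudoMetrizableSpacePseudoMetric Ω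
  set g : ℚ × ℕ × ℕ × ℕ → Ω →ᵇ ℝ := fun i =>
    distTrunc (TopologicalSpace.denseSeq Ω i.2.1) i.1 i.2.2.1 i.2.2.2
  set Φ : Finset (ℚ × ℕ × ℕ × ℕ) → Ω →ᵇ ℝ := fun s => if h : s.Nonempty then s.inf' h g else 0
  refine ⟨range fun s => ρ.toL1c (Φ s), countable_range _, ?_⟩
  rw [dense_iff_closure_eq, eq_univ_iff_forall]
  intro X
  refine ρ.induction_toL1c X isClosed_closure fun f => ?_
  have hJ : ∀ x, ∀ ε > 0, ∃ i : {i // f ≤ g i}, g i x ≤ f x + ε := fun x ε hε => by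
    obtain ⟨q, j, m, M, h1, h2⟩ :=
      exists_distTrunc_le (TopologicalSpace.denseRange_denseSeq Ω) f x hε
    exact ⟨⟨(q, j, m, M), h1⟩, h2⟩
  have : Nonempty {i // f ≤ g i} := ⟨(hJ (Classical.arbitrary Ω) 1 one_pos).choose⟩
  obtain ⟨e, he⟩ := exists_surjective_nat {i // f ≤ g i}
  set S : ℕ → Finset (ℚ × ℕ × ℕ × ℕ) := fun n => (Finset.range (n + 1)).image fun k => (e k : _)
  have hS : ∀ n, (S n).Nonempty := fun n => Finset.nonempty_range_add_one.image _
  have hΦ : ∀ n, Φ (S n) = (S n).inf' (hS n) g := fun n => dif_pos (hS n)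
  have hf : ∀ n, f ≤ Φ (S n) := fun n => by
    rw [hΦ]
    refine Finset.le_inf' _ _ fun i hi => ?_
    obtain ⟨k, -, rfl⟩ := Finset.mem_image.1 hi
    exact (e k).2
  have hle : ∀ k n, k ≤ n → Φ (S n) ≤ g (e k) := fun k n hkn => by
    rw [hΦ]
    exact Finset.inf'_le _ (Finset.mem_image_of_mem _ (Finset.mem_range.2 (by omega)))
  have hanti : Antitone fun n => Φ (S n) - f := fun a b hab => by
    refine sub_le_sub_right ?_ f
    simp only [hΦ]
    exact Finset.inf'_mono _ (Finset.image_subset_image (Finset.range_mono (by omega))) _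
  have hlim := ρ.regular _ hanti fun x => by
    refine Metric.tendsto_atTop.2 fun ε hε => ?_
    obtain ⟨i, hi⟩ := hJ x (ε / 2) (by positivity)
    obtain ⟨k, rfl⟩ := he i
    refine ⟨k, fun n hn => ?_⟩
    have h1 : Φ (S n) x ≤ g (e k) x := hle k n hn x
    have h2 : f x ≤ Φ (S n) x := hf n x
    rw [Real.dist_eq, sub_zero, BoundedContinuousFunction.coe_sub, Pi.sub_apply,
      abs_of_nonneg (by linarith)]
    linarith
  refine mem_closure_of_tendsto (tendsto_iff_norm_sub_tendsto_zero.2 (hlim.congr fun n => ?_))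
    (Eventually.of_forall fun n => ⟨S n, rfl⟩)
  rw [← toL1c_sub, norm_toL1c, capacity, abs_of_nonneg (sub_nonneg.2 (hf n))]

end Separable

/-- A positive normalized contractive linear form on `L¹(c_ρ)` is the expectation under a
probability measure of the unit ball of the dual. -/
lemma exists_expect_eq {Ω : Type*} [TopologicalSpace Ω] [TopologicalSpace.PseudoMetrizableSpace Ω]
    [MeasurableSpace Ω] [BorelSpace Ω] {ρ : RegularSublinearRiskMeasure Ω} {g : ρ.L1c →ₗ[ℝ] ℝ}
    (hpos : ∀ X ∈ ρ.posCone, 0 ≤ g X)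
    (hone : g (ρ.toL1c (BoundedContinuousFunction.const Ω 1)) = 1) (hnorm : ∀ X, |g X| ≤ ‖X‖) :
    ∃ Q : ProbabilityMeasure Ω, ρ.MemDualBall Q ∧ ∀ X, ρ.expect Q X = g X := by
  let l : (Ω →ᵇ ℝ) →ₗ[ℝ] ℝ :=
    { toFun := fun f => g (ρ.toL1c f)
      map_add' := fun f h => by rw [toL1c_add, map_add]
      map_smul' := fun a f => by rw [toL1c_smul, map_smul]; rfl }
  -- Contractivity squeezes `l (f n)` between `0` and `c_ρ(f_n) = ρ(-f_n)`, which tends to `0` by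
  -- regularity.
  have hreg : ∀ f : ℕ → Ω →ᵇ ℝ, Antitone f → (∀ ω, Tendsto (fun n => f n ω) atTop (𝓝 0)) →
      Tendsto (fun n => l (f n)) atTop (𝓝 0) := by
    intro f hf hlim
    have hf0 : ∀ n, 0 ≤ f n := fun n ω => by
      have hω : Antitone fun n => f n ω := fun a b hab => hf hab ω
      exact hω.le_of_tendsto (hlim ω) n
    refine squeeze_zero (fun n => hpos _ (ρ.toL1c_mem_posCone (hf0 n))) (fun n => ?_)
      (ρ.regular f hf hlim)
    have h1 := (le_abs_self _).trans (hnorm (ρ.toL1c (f n)))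
    rw [norm_toL1c, capacity, abs_of_nonneg (hf0 n)] at h1
    exact h1
  obtain ⟨Q, hQ⟩ := exists_probabilityMeasure_integral_eq (l := l)
    (fun f hf => hpos _ (ρ.toL1c_mem_posCone hf)) hone hreg
  have hnorm' : ∀ X, ‖g X‖ ≤ 1 * ‖X‖ := fun X => by rw [one_mul]; exact hnorm X
  have hQm : ρ.MemDualBall Q := ⟨g.mkContinuous 1 hnorm',
    g.mkContinuous_norm_le zero_le_one _, fun f => (hQ f).symm⟩
  exact ⟨Q, hQm, fun X => ρ.expect_eq_of_forall (l := g.mkContinuous 1 hnorm') hQm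
    (fun f => (hQ f).symm) X⟩

/-! ## The sublinear expectation `X ↦ E_P(ρ_s(-X))` -/

section Dynamic

variable {Ω : Type*} [TopologicalSpace Ω] {E : ℝ≥0 → Type*} [∀ t, TopologicalSpace (E t)]
  {π : ∀ t, Ω → E t} {ρ : RegularSublinearRiskMeasure Ω} {r : ℝ≥0 → ρ.L1c → ρ.L1c}

lemma FactorizesInto.map_zero (hr : ρ.FactorizesInto π r) (s : ℝ≥0) : r s 0 = 0 := by
  have := hr.dynamic.pos_homog s 0 0 le_rfl
  rwa [zero_smul, zero_smul] at this

lemma const_mem_CbUpTo (t : ℝ≥0) (a : ℝ) : BoundedContinuousFunction.const Ω a ∈ CbUpTo π t :=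
  ⟨BoundedContinuousFunction.const _ a, fun _ => rfl⟩

lemma neg_mem_CbUpTo {t : ℝ≥0} {f : Ω →ᵇ ℝ} (hf : f ∈ CbUpTo π t) : -f ∈ CbUpTo π t := by
  obtain ⟨g, hg⟩ := hf
  exact ⟨-g, fun ω => congrArg Neg.neg (hg ω)⟩

lemma toL1c_mem_L1cUpTo {t : ℝ≥0} {f : Ω →ᵇ ℝ} (hf : f ∈ CbUpTo π t) :
    ρ.toL1c f ∈ ρ.L1cUpTo π t :=
  subset_closure ⟨f, hf, rfl⟩

variable [MeasurableSpace Ω] [BorelSpace Ω] {P Q : ProbabilityMeasure Ω}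

variable (ρ) in
/-- The sublinear expectation `X ↦ E_P(ρ_s(-X))`. -/
noncomputable def dynExpect (r : ℝ≥0 → ρ.L1c → ρ.L1c) (P : ProbabilityMeasure Ω) (s : ℝ≥0)
    (X : ρ.L1c) : ℝ :=
  ρ.expect P (r s (-X))

lemma dynExpect_mono (hr : ρ.FactorizesInto π r) (hP : ρ.MemDualBall P) (s : ℝ≥0) {X Y : ρ.L1c}
    (h : ρ.LeL1c X Y) : ρ.dynExpect r P s X ≤ ρ.dynExpect r P s Y := by
  refine ρ.expect_mono hP (hr.dynamic.anti s _ _ ?_)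
  rwa [leL1c_iff, neg_sub_neg]

lemma dynExpect_add (hr : ρ.FactorizesInto π r) (hP : ρ.MemDualBall P) (s : ℝ≥0) (X Y : ρ.L1c) :
    ρ.dynExpect r P s (X + Y) ≤ ρ.dynExpect r P s X + ρ.dynExpect r P s Y := by
  rw [dynExpect, dynExpect, dynExpect, neg_add, ← expect_add _ hP]
  exact ρ.expect_mono hP (hr.dynamic.subadd s _ _)

lemma dynExpect_smul (hr : ρ.FactorizesInto π r) (hP : ρ.MemDualBall P) (s : ℝ≥0) (a : ℝ)
    (X : ρ.L1c) (ha : 0 ≤ a) : ρ.dynExpect r P s (a • X) = a * ρ.dynExpect r P s X := by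
  rw [dynExpect, dynExpect, ← smul_neg, hr.dynamic.pos_homog s a _ ha, expect_smul _ hP]

lemma dynExpect_zero (hr : ρ.FactorizesInto π r) (hP : ρ.MemDualBall P) (s : ℝ≥0) :
    ρ.dynExpect r P s 0 = 0 := by
  have := dynExpect_smul hr hP s 0 0 le_rfl
  rwa [zero_smul, zero_mul] at this

/-- Translating `-Z` by `Z` gives `0 = r s 0 = r s (-Z) - Z`. -/
lemma dynExpect_eq_expect (hr : ρ.FactorizesInto π r) (s : ℝ≥0)
    {Z : ρ.L1c} (hZ : Z ∈ ρ.L1cUpTo π s) : ρ.dynExpect r P s Z = ρ.expect P Z := by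
  have h := hr.dynamic.translation s (-Z) Z hZ
  rw [neg_add_cancel, hr.map_zero, eq_comm, sub_eq_zero] at h
  rw [dynExpect, h]

/-- For `f ≥ 0` in `C_b(Ω)`, `r 0 (-f)` is the constant `ρ(-f) = c_ρ(f)`; `eq_norm_of_sublinear`
extends this to the cone. -/
lemma dynExpect_zero_time (hr : ρ.FactorizesInto π r) (hP : ρ.MemDualBall P) {W : ρ.L1c}
    (hW : W ∈ ρ.posCone) : ρ.dynExpect r P 0 W = ‖W‖ := by
  refine ρ.eq_norm_of_sublinear (fun X Y => dynExpect_mono hr hP 0) (dynExpect_add hr hP 0)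
    (dynExpect_smul hr hP 0) (fun f hf => ?_) hW
  rw [dynExpect, ← toL1c_neg, hr.extends_toFun, expect_toL1c _ hP, norm_toL1c, capacity,
    abs_of_nonneg hf]
  simp

/-- Put `Z = ρ_s(-|X|)`, an element of the cone. Its norm is the time-zero value of `Z`, and time
consistency `ρ_0(-ρ_s(-|X|)) = ρ_0(-|X|)` identifies it with `‖X‖`. -/
lemma dynExpect_le_norm (hr : ρ.FactorizesInto π r) (hP : ρ.MemDualBall P) (s : ℝ≥0)
    (X : ρ.L1c) : ρ.dynExpect r P s X ≤ ‖X‖ := by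
  have hZ : r s (-ρ.absL X) ∈ ρ.posCone := by
    have : ρ.LeL1c (-ρ.absL X) 0 := by
      rw [leL1c_iff, zero_sub, neg_neg]
      exact ρ.absL_mem_posCone X
    have := hr.dynamic.anti s _ _ this
    rwa [hr.map_zero, leL1c_iff, sub_zero] at this
  calc ρ.dynExpect r P s X ≤ ρ.expect P (r s (-ρ.absL X)) :=
        dynExpect_mono hr hP s (ρ.leL1c_absL X)
    _ ≤ ‖r s (-ρ.absL X)‖ := ρ.expect_le_norm hP _
    _ = ρ.dynExpect r P 0 (r s (-ρ.absL X)) := (dynExpect_zero_time hr hP hZ).symm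
    _ = ρ.dynExpect r P 0 (ρ.absL X) := by
        rw [dynExpect, dynExpect, ← hr.time_consistent 0 s zero_le]
    _ = ‖X‖ := by rw [dynExpect_zero_time hr hP (ρ.absL_mem_posCone X), norm_absL]

/-- Every value of the sublinear expectation is attained by a dominated probability measure of
the unit ball of the dual. -/
lemma exists_expect_le_dynExpect [TopologicalSpace.PseudoMetrizableSpace Ω]
    (hr : ρ.FactorizesInto π r) (hP : ρ.MemDualBall P) (s : ℝ≥0) (X₀ : ρ.L1c) :
    ∃ Q : ProbabilityMeasure Ω, ρ.MemDualBall Q ∧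
      (∀ X, ρ.expect Q X ≤ ρ.dynExpect r P s X) ∧ ρ.expect Q X₀ = ρ.dynExpect r P s X₀ := by
  obtain ⟨g, hg0, hg⟩ := exists_linearMap_le_sublinear (ρ.dynExpect r P s)
    (dynExpect_smul hr hP s) (dynExpect_add hr hP s) X₀
  have hneg : ∀ X, -ρ.dynExpect r P s (-X) ≤ g X := fun X => by
    have := hg (-X)
    rw [map_neg] at this
    linarith
  have hpos : ∀ X ∈ ρ.posCone, 0 ≤ g X := fun X hX => by
    have h1 : ρ.LeL1c (-X) 0 := by rwa [leL1c_iff, zero_sub, neg_neg]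
    have h2 := dynExpect_mono hr hP s h1
    rw [dynExpect_zero hr hP] at h2
    linarith [hneg X]
  have hnorm : ∀ X, |g X| ≤ ‖X‖ := fun X => by
    have h1 := dynExpect_le_norm hr hP s (-X)
    rw [norm_neg] at h1
    exact abs_le.2 ⟨by linarith [hneg X], (hg X).trans (dynExpect_le_norm hr hP s X)⟩
  -- On constants the sublinear bound is linear, so the bounds for `1` and `-1` pinch `g`.
  have hone : g (ρ.toL1c (BoundedContinuousFunction.const Ω 1)) = 1 := by
    have hc : BoundedContinuousFunction.const Ω (1 : ℝ) ∈ CbUpTo π s := const_mem_CbUpTo s 1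
    have h1 := hg (ρ.toL1c (BoundedContinuousFunction.const Ω 1))
    have h2 := hneg (ρ.toL1c (BoundedContinuousFunction.const Ω 1))
    rw [dynExpect_eq_expect hr s (toL1c_mem_L1cUpTo hc), expect_toL1c _ hP] at h1
    rw [← toL1c_neg, dynExpect_eq_expect hr s (toL1c_mem_L1cUpTo (neg_mem_CbUpTo hc)),
      toL1c_neg, expect_neg _ hP, neg_neg, expect_toL1c _ hP] at h2
    have h3 := le_antisymm h1 h2
    rw [h3]
    simp
  obtain ⟨Q, hQ, he⟩ := exists_expect_eq (g := g) hpos hone hnorm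
  exact ⟨Q, hQ, fun X => (he X).trans_le (hg X), (he X₀).trans hg0⟩

/-- On `C_b(Ω_s)` the dominating functional is the linear form `E_P`, and a linear form dominated by
a linear form equals it. The images of `Q` and `P` on `E s` therefore have the same integrals of
bounded continuous functions. -/
lemma measure_eq_of_expect_le (hr : ρ.FactorizesInto π r) (hP : ρ.MemDualBall P)
    {s : ℝ≥0} [TopologicalSpace.PseudoMetrizableSpace (E s)] (hπ : Continuous (π s))
    (hQ : ρ.MemDualBall Q) (hle : ∀ X, ρ.expect Q X ≤ ρ.dynExpect r P s X) (A : Set Ω)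
    (hA : MeasurableSet[(borel (E s)).comap (π s)] A) :
    (Q : Measure Ω) A = (P : Measure Ω) A := by
  let _ : MeasurableSpace (E s) := borel (E s)
  have : BorelSpace (E s) := ⟨rfl⟩
  have hint : ∀ f ∈ CbUpTo π s, ∫ ω, f ω ∂(Q : Measure Ω) = ∫ ω, f ω ∂(P : Measure Ω) := by
    have h1 : ∀ f ∈ CbUpTo π s, ∫ ω, f ω ∂(Q : Measure Ω) ≤ ∫ ω, f ω ∂(P : Measure Ω) := by
      intro f hf
      have := hle (ρ.toL1c f)
      rwa [dynExpect_eq_expect hr s (toL1c_mem_L1cUpTo hf), expect_toL1c _ hP,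
        expect_toL1c _ hQ] at this
    intro f hf
    refine le_antisymm (h1 f hf) ?_
    have := h1 _ (neg_mem_CbUpTo hf)
    simp only [BoundedContinuousFunction.coe_neg, Pi.neg_apply, integral_neg] at this
    linarith
  have hmap : (Q : Measure Ω).map (π s) = (P : Measure Ω).map (π s) := by
    refine ext_of_forall_integral_eq_of_IsFiniteMeasure fun g => ?_
    rw [integral_map hπ.aemeasurable g.continuous.aestronglyMeasurable,
      integral_map hπ.aemeasurable g.continuous.aestronglyMeasurable]
    exact hint (g.compContinuous ⟨π s, hπ⟩) ⟨g, fun _ => rfl⟩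
  obtain ⟨B, hB, rfl⟩ := hA
  rw [← Measure.map_apply hπ.measurable hB, hmap, Measure.map_apply hπ.measurable hB]

end Dynamic

end RegularSublinearRiskMeasure

/-! ### Measures and integrals on a sub-σ-algebra -/

/-- A function measurable for the `σ`-algebra of a continuous map `π` is a.e. non negative if its
integrals against all non negative bounded continuous functions of `π` are. -/
lemma ae_nonneg_of_forall_integral_mul_nonneg {Ω E : Type*} [TopologicalSpace Ω]
    [MeasurableSpace Ω] [BorelSpace Ω] [TopologicalSpace E]
    [TopologicalSpace.PseudoMetrizableSpace E] {π : Ω → E} (hπ : Continuous π) {μ : Measure Ω}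
    [IsFiniteMeasure μ] {D : Ω → ℝ} (hD : StronglyMeasurable[(borel E).comap π] D)
    (hDi : Integrable D μ) (h : ∀ F : E →ᵇ ℝ, 0 ≤ F → 0 ≤ ∫ ω, F (π ω) * D ω ∂μ) :
    0 ≤ᵐ[μ] D := by
  let _ : MeasurableSpace E := borel E
  have : BorelSpace E := ⟨rfl⟩
  have hA : MeasurableSet[(borel E).comap π] {ω | D ω < 0} :=
    hD.measurable measurableSet_Iio
  obtain ⟨B, hB, hBA⟩ := hA
  by_contra hne
  have hpos : μ (π ⁻¹' B) ≠ 0 := by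
    rw [hBA]
    intro h0
    apply hne
    rw [EventuallyLE, ae_iff]
    simpa using h0
  rw [← Measure.map_apply hπ.measurable hB] at hpos
  -- Inner regularity with error equal to the whole mass of `B` says exactly that `C` has positive
  -- mass. The indicator of a closed set is a limit of bounded continuous functions, to which the
  -- hypothesis applies.
  obtain ⟨C, hCB, hC, hlt⟩ := hB.exists_isClosed_lt_add (measure_ne_top (μ.map π) B) hpos
  have hCpos : 0 < μ (π ⁻¹' C) := by
    rw [← Measure.map_apply hπ.measurable hC.measurableSet, pos_iff_ne_zero]
    intro h0
    rw [h0, zero_add] at hlt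
    exact lt_irrefl _ hlt
  have hneg : ∀ ω ∈ π ⁻¹' C, D ω < 0 := fun ω hω => by
    have : ω ∈ π ⁻¹' B := hCB hω
    rwa [hBA] at this
  have hCm : MeasurableSet (π ⁻¹' C) := (hC.preimage hπ).measurableSet
  have hlim : Tendsto (fun n => ∫ ω, (hC.apprSeq n (π ω) : ℝ) * D ω ∂μ) atTop
      (𝓝 (∫ ω, (π ⁻¹' C).indicator D ω ∂μ)) := by
    refine tendsto_integral_of_dominated_convergence (fun ω => ‖D ω‖) (fun n => ?_) hDi.norm
      (fun n => ?_) ?_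
    · refine AEStronglyMeasurable.mul ?_ hDi.aestronglyMeasurable
      exact (NNReal.continuous_coe.comp ((hC.apprSeq n).continuous.comp hπ)).aestronglyMeasurable
    · refine Eventually.of_forall fun ω => ?_
      rw [norm_mul]
      refine mul_le_of_le_one_left (norm_nonneg _) ?_
      rw [Real.norm_of_nonneg (NNReal.coe_nonneg _)]
      exact_mod_cast HasOuterApproxClosed.apprSeq_apply_le_one hC n (π ω)
    · refine Eventually.of_forall fun ω => ?_
      have h1 := tendsto_pi_nhds.1 (HasOuterApproxClosed.tendsto_apprSeq hC) (π ω)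
      have h2 := ((NNReal.tendsto_coe.2 h1).mul_const (D ω))
      refine h2.trans (le_of_eq ?_)
      congr 1
      by_cases hω : π ω ∈ C
      · rw [indicator_of_mem hω, indicator_of_mem (show ω ∈ π ⁻¹' C from hω)]
        simp
      · rw [indicator_of_notMem hω, indicator_of_notMem (show ω ∉ π ⁻¹' C from hω)]
        simp
  have hge : 0 ≤ ∫ ω in π ⁻¹' C, D ω ∂μ := by
    rw [← integral_indicator hCm]
    refine ge_of_tendsto' hlim fun n => ?_
    exact h ⟨⟨fun x => (hC.apprSeq n x : ℝ), NNReal.continuous_coe.comp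
      (hC.apprSeq n).continuous⟩, (hC.apprSeq n).map_bounded'⟩ fun x => NNReal.coe_nonneg _
  have hlt' : 0 < ∫ ω in π ⁻¹' C, -D ω ∂μ := by
    rw [setIntegral_pos_iff_support_of_nonneg_ae
      (ae_restrict_of_forall_mem hCm fun ω hω => neg_nonneg.2 (hneg ω hω).le) hDi.neg.integrableOn]
    refine hCpos.trans_le (measure_mono fun ω hω => ⟨?_, hω⟩)
    exact neg_ne_zero.2 (hneg ω hω).ne
  rw [integral_neg] at hlt'
  linarith

lemma trim_eq_trim_of_forall {Ω : Type*} {m m₀ : MeasurableSpace Ω} (hm : m ≤ m₀)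
    {μ ν : @Measure Ω m₀} (h : ∀ A, MeasurableSet[m] A → μ A = ν A) : μ.trim hm = ν.trim hm := by
  refine @Measure.ext _ m _ _ fun A hA => ?_
  rw [trim_measurableSet_eq hm hA, trim_measurableSet_eq hm hA, h A hA]

lemma integral_eq_of_trim_eq {Ω : Type*} {m m₀ : MeasurableSpace Ω} (hm : m ≤ m₀)
    {μ ν : @Measure Ω m₀} (h : μ.trim hm = ν.trim hm) {f : Ω → ℝ} (hf : StronglyMeasurable[m] f) :
    ∫ ω, f ω ∂μ = ∫ ω, f ω ∂ν := by
  rw [integral_trim hm hf, h, ← integral_trim hm hf]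

lemma integrable_of_trim_eq {Ω : Type*} {m m₀ : MeasurableSpace Ω} (hm : m ≤ m₀)
    {μ ν : @Measure Ω m₀} (h : μ.trim hm = ν.trim hm) {f : Ω → ℝ} (hf : StronglyMeasurable[m] f)
    (hi : Integrable f μ) : Integrable f ν := by
  refine integrable_of_integrable_trim hm ?_
  rw [← h]
  exact hi.trim hm hf

lemma BoundedContinuousFunction.stronglyMeasurable_comap {Ω E : Type*} [TopologicalSpace E]
    (π : Ω → E) (F : E →ᵇ ℝ) : StronglyMeasurable[(borel E).comap π] fun ω => F (π ω) := by
  let _ : MeasurableSpace E := borel E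
  have : BorelSpace E := ⟨rfl⟩
  exact (F.continuous.measurable.comp (comap_measurable π)).stronglyMeasurable

/-! ### Representation of `ρ_s` by conditional expectations -/

namespace RegularSublinearRiskMeasure

variable {Ω : Type*} [TopologicalSpace Ω] {E : ℝ≥0 → Type*} [∀ t, TopologicalSpace (E t)]
  {π : ∀ t, Ω → E t} {ρ : RegularSublinearRiskMeasure Ω} {r : ℝ≥0 → ρ.L1c → ρ.L1c}
  [MeasurableSpace Ω] [BorelSpace Ω] {P Q : ProbabilityMeasure Ω}

lemma comap_borel_le {s : ℝ≥0} (hπ : Continuous (π s)) :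
    (borel (E s)).comap (π s) ≤ ‹MeasurableSpace Ω› := by
  let _ : MeasurableSpace (E s) := borel (E s)
  have : BorelSpace (E s) := ⟨rfl⟩
  exact hπ.measurable.comap_le

/-- Measurability up to null sets for a sub-σ-algebra is a closed condition in `L¹(P)`, and it holds
on `C_b(Ω_s)`. -/
lemma aestronglyMeasurable_toLp {s : ℝ≥0} (hπ : Continuous (π s)) (hP : ρ.MemDualBall P)
    {Z : ρ.L1c} (hZ : Z ∈ ρ.L1cUpTo π s) :
    AEStronglyMeasurable[(borel (E s)).comap (π s)] (ρ.toLp P Z) (P : Measure Ω) := by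
  have hcl : IsClosed {Z : ρ.L1c | AEStronglyMeasurable[(borel (E s)).comap (π s)]
      (ρ.toLp P Z) (P : Measure Ω)} :=
    (isClosed_aestronglyMeasurable (F := ℝ) (p := 1) (μ := (P : Measure Ω))
      (comap_borel_le hπ)).preimage ρ.continuous_toLp
  refine closure_minimal ?_ hcl hZ
  rintro _ ⟨f, ⟨F, hF⟩, rfl⟩
  rw [mem_ofPred_eq, toLp_toL1c _ hP]
  refine ⟨fun ω => F (π s ω), F.stronglyMeasurable_comap (π s), ?_⟩
  filter_upwards [BoundedContinuousFunction.coeFn_toLp (p := 1) (P : Measure Ω) ℝ f] with ω hω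
  rw [hω, hF]

section CondExp

variable {s : ℝ≥0} [TopologicalSpace.PseudoMetrizableSpace (E s)]

/-- The conditional expectation is taken under `Q` but compared under `P`. It is strongly measurable
for the σ-algebra on which the two measures agree, so integrability carries over. -/
lemma integrable_condExp_toLp (hr : ρ.FactorizesInto π r) (hP : ρ.MemDualBall P)
    (hπ : Continuous (π s)) (hQ : ρ.MemDualBall Q)
    (hle : ∀ X, ρ.expect Q X ≤ ρ.dynExpect r P s X) (X : ρ.L1c) :
    Integrable ((Q : Measure Ω)[ρ.toLp Q X | (borel (E s)).comap (π s)]) (P : Measure Ω) :=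
  integrable_of_trim_eq (comap_borel_le hπ)
    (trim_eq_trim_of_forall _ (measure_eq_of_expect_le hr hP hπ hQ hle))
    stronglyMeasurable_condExp integrable_condExp

lemma integral_condExp_toLp (hr : ρ.FactorizesInto π r) (hP : ρ.MemDualBall P)
    (hπ : Continuous (π s)) (hQ : ρ.MemDualBall Q)
    (hle : ∀ X, ρ.expect Q X ≤ ρ.dynExpect r P s X) (X : ρ.L1c) :
    ∫ ω, ((Q : Measure Ω)[ρ.toLp Q X | (borel (E s)).comap (π s)]) ω ∂(P : Measure Ω) =
      ρ.expect Q X := by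
  rw [← integral_eq_of_trim_eq (comap_borel_le hπ)
    (trim_eq_trim_of_forall _ (measure_eq_of_expect_le hr hP hπ hQ hle))
    stronglyMeasurable_condExp, integral_condExp (comap_borel_le hπ), expect]

lemma integral_sub_condExp_toLp (hr : ρ.FactorizesInto π r) (hP : ρ.MemDualBall P)
    (hπ : Continuous (π s)) (hQ : ρ.MemDualBall Q)
    (hle : ∀ X, ρ.expect Q X ≤ ρ.dynExpect r P s X) (X : ρ.L1c) :
    ∫ ω, (ρ.toLp P (r s X) ω -
        ((Q : Measure Ω)[ρ.toLp Q (-X) | (borel (E s)).comap (π s)]) ω) ∂(P : Measure Ω) =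
      ρ.dynExpect r P s (-X) - ρ.expect Q (-X) := by
  rw [integral_sub (L1.integrable_coeFn _) (integrable_condExp_toLp hr hP hπ hQ hle _),
    integral_condExp_toLp hr hP hπ hQ hle, dynExpect, neg_neg]
  rfl

/-- Testing against `0 ≤ f` in `C_b(Ω_s)` reduces the claim to `E_Q(-fX) ≤ E_P(f ρ_s(X))`.
Domination of `Q` gives `E_P(ρ_s(fX))` as an intermediate bound, and the local property `ρ_s(fX) ≤ f
ρ_s(X)` concludes. -/
lemma condExp_toLp_le (hr : ρ.FactorizesInto π r) (hP : ρ.MemDualBall P)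
    (hπ : Continuous (π s)) (hQ : ρ.MemDualBall Q)
    (hle : ∀ X, ρ.expect Q X ≤ ρ.dynExpect r P s X) (X : ρ.L1c) :
    (Q : Measure Ω)[ρ.toLp Q (-X) | (borel (E s)).comap (π s)] ≤ᵐ[(P : Measure Ω)]
      ρ.toLp P (r s X) := by
  have hm := comap_borel_le hπ
  set g := (Q : Measure Ω)[ρ.toLp Q (-X) | (borel (E s)).comap (π s)] with hg
  have hgm : StronglyMeasurable[(borel (E s)).comap (π s)] g := stronglyMeasurable_condExp
  have hgP : Integrable g (P : Measure Ω) := integrable_condExp_toLp hr hP hπ hQ hle (-X)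
  -- The test lemma needs a function genuinely measurable for the sub-σ-algebra, whence this version
  -- of `ρ_s(X)`.
  obtain ⟨h, hhm, hh⟩ := aestronglyMeasurable_toLp hπ hP (hr.dynamic.mem s X)
  have hhP : Integrable h (P : Measure Ω) := (L1.integrable_coeFn _).congr hh
  suffices H : 0 ≤ᵐ[(P : Measure Ω)] h - g by
    filter_upwards [H, hh] with ω h1 h2
    rw [h2]
    simpa using h1
  refine ae_nonneg_of_forall_integral_mul_nonneg hπ (hhm.sub hgm) (hhP.sub hgP) fun F hF => ?_
  set f : Ω →ᵇ ℝ := F.compContinuous ⟨π s, hπ⟩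
  have hf : f ∈ CbUpTo π s := ⟨F, fun _ => rfl⟩
  have hfm : StronglyMeasurable[(borel (E s)).comap (π s)] f := F.stronglyMeasurable_comap (π s)
  have hfi : ∀ {μ : Measure Ω} {u : Ω → ℝ}, Integrable u μ → Integrable (fun ω => f ω * u ω) μ :=
    fun hu => hu.bdd_mul f.continuous.aestronglyMeasurable
      (Eventually.of_forall f.norm_coe_le_norm)
  have e1 : ∫ ω, f ω * h ω ∂(P : Measure Ω) = ρ.expect P (ρ.mulL1c f (r s X)) := by
    rw [expect_mulL1c _ hP]
    refine integral_congr_ae ?_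
    filter_upwards [hh] with ω hω
    rw [hω]
  have e2 : ∫ ω, f ω * g ω ∂(P : Measure Ω) = ρ.expect Q (ρ.mulL1c f (-X)) := by
    have h0 : ∫ ω, f ω * g ω ∂(Q : Measure Ω) = ∫ ω, f ω * g ω ∂(P : Measure Ω) :=
      integral_eq_of_trim_eq hm
        (trim_eq_trim_of_forall _ (measure_eq_of_expect_le hr hP hπ hQ hle)) (hfm.mul hgm)
    rw [expect_mulL1c _ hQ, ← h0]
    have h1 := condExp_mul_of_stronglyMeasurable_left hfm
      (hfi (L1.integrable_coeFn (ρ.toLp Q (-X)))) (L1.integrable_coeFn (ρ.toLp Q (-X)))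
    have h2 := integral_congr_ae h1
    rw [integral_condExp hm] at h2
    exact h2.symm
  have e3 : ∫ ω, F (π s ω) * (h - g) ω ∂(P : Measure Ω) =
      ∫ ω, f ω * h ω ∂(P : Measure Ω) - ∫ ω, f ω * g ω ∂(P : Measure Ω) := by
    rw [← integral_sub (hfi hhP) (hfi hgP)]
    refine integral_congr_ae (Eventually.of_forall fun ω => ?_)
    exact mul_sub (f ω) (h ω) (g ω)
  rw [e3, e1, e2, sub_nonneg, map_neg]
  refine (hle _).trans ?_
  rw [dynExpect, neg_neg]
  exact ρ.expect_mono hP (hr.mul_le s f hf (fun ω => hF (π s ω)) X)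

lemma toLp_eq_condExp (hr : ρ.FactorizesInto π r) (hP : ρ.MemDualBall P)
    (hπ : Continuous (π s)) (hQ : ρ.MemDualBall Q)
    (hle : ∀ X, ρ.expect Q X ≤ ρ.dynExpect r P s X) {X : ρ.L1c}
    (hX : ρ.expect Q (-X) = ρ.dynExpect r P s (-X)) :
    (ρ.toLp P (r s X) : Ω → ℝ) =ᵐ[(P : Measure Ω)]
      (Q : Measure Ω)[ρ.toLp Q (-X) | (borel (E s)).comap (π s)] := by
  have h1 := integral_sub_condExp_toLp hr hP hπ hQ hle X
  have h2 := condExp_toLp_le hr hP hπ hQ hle X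
  rw [hX, sub_self] at h1
  have h3 := (integral_eq_zero_iff_of_nonneg_ae
    (by filter_upwards [h2] with ω hω; exact sub_nonneg.2 hω)
    ((L1.integrable_coeFn _).sub (integrable_condExp_toLp hr hP hπ hQ hle _))).1 h1
  filter_upwards [h3] with ω hω
  exact sub_eq_zero.1 hω

/-- For a majorant `W` of the family, the positive part of `ρ_s(X) - W` is at most the gap `ρ_s(X) -
E_{Q_n}(-X | B_s)` for every `n`. This gap is nonnegative with integral `N(-X) - E_{Q_n}(-X)`, where
`N = ρ.dynExpect r P s`; it vanishes for `D n` in place of `X`, and replacing `D n` by `X` costs at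
most `‖X - D n‖` in each term. -/
lemma isEssSup_condExp (hr : ρ.FactorizesInto π r) (hP : ρ.MemDualBall P)
    (hπ : Continuous (π s)) {D : ℕ → ρ.L1c} (hD : DenseRange D)
    {Q : ℕ → ProbabilityMeasure Ω} (hQ : ∀ n, ρ.MemDualBall (Q n))
    (hle : ∀ n X, ρ.expect (Q n) X ≤ ρ.dynExpect r P s X)
    (hDQ : ∀ n, ρ.expect (Q n) (-D n) = ρ.dynExpect r P s (-D n)) (X : ρ.L1c) :
    IsEssSup (P : Measure Ω)
      (fun n => (Q n : Measure Ω)[ρ.toLp (Q n) (-X) | (borel (E s)).comap (π s)])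
      (ρ.toLp P (r s X)) := by
  refine ⟨(L1.integrable_coeFn _).aemeasurable, fun n => condExp_toLp_le hr hP hπ (hQ n) (hle n) X,
    fun W hW hYW => ?_⟩
  have hbound : ∀ ε : ℝ, 0 < ε →
      ∫⁻ ω, ENNReal.ofReal (ρ.toLp P (r s X) ω - W ω) ∂(P : Measure Ω) ≤ ENNReal.ofReal ε := by
    intro ε hε
    -- Half of `ε` is for the change in the sublinear expectation, half for the change in `E_{Q_n}`.
    obtain ⟨n, hn⟩ := hD.exists_dist_lt X (half_pos hε)
    rw [dist_eq_norm] at hn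
    set Y := (Q n : Measure Ω)[ρ.toLp (Q n) (-X) | (borel (E s)).comap (π s)] with hY
    have h1 : ρ.dynExpect r P s (-X) ≤ ρ.dynExpect r P s (-D n) + ‖X - D n‖ := by
      have h2 := dynExpect_add hr hP s (-D n) (-(X - D n))
      have h3 := dynExpect_le_norm hr hP s (-(X - D n))
      rw [norm_neg] at h3
      rw [show -D n + -(X - D n) = -X by abel] at h2
      linarith
    have h4 : ρ.expect (Q n) (-D n) - ‖X - D n‖ ≤ ρ.expect (Q n) (-X) := by
      have h5 := ρ.expect_le_norm (hQ n) (X - D n)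
      rw [expect_sub _ (hQ n)] at h5
      rw [expect_neg _ (hQ n), expect_neg _ (hQ n)]
      linarith
    calc ∫⁻ ω, ENNReal.ofReal (ρ.toLp P (r s X) ω - W ω) ∂(P : Measure Ω)
        ≤ ∫⁻ ω, ENNReal.ofReal (ρ.toLp P (r s X) ω - Y ω) ∂(P : Measure Ω) := by
          refine lintegral_mono_ae ?_
          filter_upwards [hYW n] with ω hω
          exact ENNReal.ofReal_le_ofReal (sub_le_sub_left hω _)
      _ = ENNReal.ofReal (∫ ω, (ρ.toLp P (r s X) ω - Y ω) ∂(P : Measure Ω)) := by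
          refine (ofReal_integral_eq_lintegral_ofReal ((L1.integrable_coeFn _).sub
            (integrable_condExp_toLp hr hP hπ (hQ n) (hle n) _)) ?_).symm
          filter_upwards [condExp_toLp_le hr hP hπ (hQ n) (hle n) X] with ω hω
          exact sub_nonneg.2 hω
      _ ≤ _ := by
          rw [hY, integral_sub_condExp_toLp hr hP hπ (hQ n) (hle n) X]
          refine ENNReal.ofReal_le_ofReal ?_
          linarith [hDQ n]
  have hzero : ∫⁻ ω, ENNReal.ofReal (ρ.toLp P (r s X) ω - W ω) ∂(P : Measure Ω) = 0 := by
    refine le_antisymm (ENNReal.le_of_forall_pos_le_add fun ε hε _ => ?_) zero_le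
    rw [zero_add, ← ENNReal.ofReal_coe_nnreal]
    exact hbound ε hε
  have hae := (lintegral_eq_zero_iff'
    (((L1.integrable_coeFn _).aemeasurable.sub hW).ennreal_ofReal)).1 hzero
  filter_upwards [hae] with ω hω
  exact sub_nonpos.1 (ENNReal.ofReal_eq_zero.1 hω)

end CondExp

end RegularSublinearRiskMeasure

/-! ### The main theorem -/

theorem mainTheorem12 (d : ℕ) (k : PathKind)
    (ρ : RegularSublinearRiskMeasure (PathSpace d k))
    (r : ℝ≥0 → ρ.L1c → ρ.L1c) (hr : ρ.FactorizesInto (pathRestrict d k) r)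
    (P : ProbabilityMeasure (PathSpace d k)) (hP : ρ.IsCanonical P) (s : ℝ≥0) :
    (∃ Q : ℕ → ProbabilityMeasure (PathSpace d k),
      (∀ n, ρ.MemDualBall (Q n)) ∧
      (∀ n A, MeasurableSet[pathSigma d k s] A →
        (Q n : Measure (PathSpace d k)) A = (P : Measure (PathSpace d k)) A) ∧
      ∀ X : ρ.L1c, IsEssSup (P : Measure (PathSpace d k))
        (fun n => (Q n : Measure (PathSpace d k))[ρ.toLp (Q n) (-X) | pathSigma d k s])
        (ρ.toLp P (r s X))) ∧
    ∀ X : ρ.L1c, ∃ Q : ProbabilityMeasure (PathSpace d k),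
      ρ.MemDualBall Q ∧
      (∀ A, MeasurableSet[pathSigma d k s] A →
        (Q : Measure (PathSpace d k)) A = (P : Measure (PathSpace d k)) A) ∧
      (ρ.toLp P (r s X) : PathSpace d k → ℝ) =ᵐ[(P : Measure (PathSpace d k))]
        (Q : Measure (PathSpace d k))[ρ.toLp Q (-X) | pathSigma d k s] := by
  have hπ := continuous_pathRestrict d k s
  have hex := RegularSublinearRiskMeasure.exists_expect_le_dynExpect hr hP.1 s
  refine ⟨?_, fun X => ?_⟩
  · have := ρ.separableSpace_L1c
    have hD := TopologicalSpace.denseRange_denseSeq ρ.L1c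
    choose Q hQ hle heq using fun n => hex (-TopologicalSpace.denseSeq ρ.L1c n)
    exact ⟨Q, hQ, fun n => RegularSublinearRiskMeasure.measure_eq_of_expect_le hr hP.1 hπ
      (hQ n) (hle n), RegularSublinearRiskMeasure.isEssSup_condExp hr hP.1 hπ hD hQ hle heq⟩
  · obtain ⟨Q, hQ, hle, heq⟩ := hex (-X)
    exact ⟨Q, hQ, RegularSublinearRiskMeasure.measure_eq_of_expect_le hr hP.1 hπ hQ hle,
      RegularSublinearRiskMeasure.toLp_eq_condExp hr hP.1 hπ hQ hle heq⟩
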